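/- Let $d\ge 1$ and $k\ge 0$ be integers, $T>0$ and $H\in(0,\tfrac12)$. Let $B^H=(B^H_t)_{t\in[0,T]}$ be a standard $d$-dimensional fractional Brownian motion with Hurst parameter $H$: a continuous centred Gaussian process in $\mathbb R^d$ with independent components and $E[B^{H,(i)}_tB^{H,(i)}_s]=\tfrac12\left(t^{2H}+s^{2H}-|t-s|^{2H}\right)$. For $0<s<t$ let $$K_H(t,s)=c_H\left[\left(\tfrac ts\right)^{H-\frac12}(t-s)^{H-\frac12}-\left(H-\tfrac12\right)s^{\frac12-H}\int_s^t u^{H-\frac32}(u-s)^{H-\frac12}\,du\right],\qquad c_H=\sqrt{\frac{2H}{(1-2H)\,\beta(1-2H,H+\frac12)}},$$ where $\beta$ is the Beta function. Assume that $$H<\min_{n\ge 1,\ (e_1,\dots,e_n)\in\{0,1\}^n}\ \frac{n-\frac12\sum_{j=1}^n e_j}{n\,d(2k+1)-\sum_{j=1}^n e_j},$$ where a quotient with zero denominator counts as $+\infty$. Let $\theta_0>0$. Then there is a constant $C>0$, depending only on $d,k,H,T$ and $\theta_0$, such that the following holds for all $m\ge1$, all $(\varepsilon_1,\dots,\varepsilon_m)\in\{0,1\}^m$,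 all multi-indices $\alpha_1,\dots,\alpha_m\in\mathbb N_0^d$ with $\alpha_j^{(l)}\le k$ for all $j,l$, all smooth compactly supported functions $f_1,\dots,f_m:[0,T]\times\mathbb R^d\to\mathbb R$, all $\theta',\theta,t$ with $\theta_0\le\theta'<\theta<t\le T$, and all $\gamma\in(0,H)$ with $\gamma\le\frac12-(d(2k+1)-1)H$. Put $\kappa_j(s)=(K_H(s,\theta)-K_H(s,\theta'))^{\varepsilon_j}$ and $\Delta^m_{\theta,t}=\{(s_m,\dots,s_1):\theta<s_m<\dots<s_1<t\}$, and let $D^{\alpha_j}$ act on the space variable. Then the integral over $\Delta^m_{\theta,t}$ below converges absolutely almost surely, is an integrable random variable, and $$\left|E\left[\int_{\Delta^m_{\theta,t}}\prod_{j=1}^m D^{\alpha_j}f_j(s_j,B^H_{s_j})\,\kappa_j(s_j)\,ds\right]\right|\le C^m\prod_{j=1}^m\|f_j\|_{L^\infty([0,T];L^1(\mathbb R^d))}\ \frac{|\theta'-\theta|^{\gamma\sum_{j=1}^m\varepsilon_j}\,|t-\theta|^{m(1-d(2k+1)H)+(H-\frac12-\gamma)\sum_{j=1}^m\varepsilon_j}}{\Gamma\left(2m(1-dH(2k+1))+1+2(H-\frac12-\gamma)\sum_{j=1}^m\varepsilon_j\right)^{1/2}}.$$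 (Given the assumption on $H$, the condition $\gamma\le\frac12-(d(2k+1)-1)H$ says exactly that the argument of $\Gamma$ is positive for all $m$ and all $\varepsilon$.) -/

import Mathlib

open MeasureTheory ProbabilityTheory Set
open scoped ContDiff

/-- The Volterra kernel `K_H(t, s)` of fractional Brownian motion, for `0 < s < t`, with the
normalising constant `c_H = √(2H / ((1 - 2H) β(1 - 2H, H + 1/2)))`. -/
noncomputable def volterraKernel (H t s : ℝ) : ℝ :=
  Real.sqrt (2 * H / ((1 - 2 * H) * ProbabilityTheory.beta (1 - 2 * H) (H + 1 / 2))) *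
    ((t / s) ^ (H - 1 / 2) * (t - s) ^ (H - 1 / 2)
      - (H - 1 / 2) * s ^ (1 / 2 - H) *
          ∫ u in s..t, u ^ (H - 3 / 2) * (u - s) ^ (H - 1 / 2))

/-- `B` is a standard `d`-dimensional fractional Brownian motion on `[0, T]` with Hurst parameter
`H`: a centred Gaussian process with almost surely continuous paths and covariance
`E[B_t^i B_s^j] = δ_ij (t^{2H} + s^{2H} - |t - s|^{2H}) / 2`; since the process is jointly Gaussian,
the vanishing cross-covariances say that the components are independent.
Only the values `B t` with `t ∈ [0, T]` matter. -/
structure IsFractionalBrownianMotion {Ω : Type*} [MeasurableSpace Ω] (P : Measure Ω)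
    (T H : ℝ) {d : ℕ} (B : ℝ → Ω → EuclideanSpace ℝ (Fin d)) : Prop where
  gaussian : IsGaussianProcess (fun t : Icc (0 : ℝ) T => B t) P
  centered : ∀ t ∈ Icc (0 : ℝ) T, ∀ i : Fin d, ∫ w, B t w i ∂P = 0
  covariance : ∀ t ∈ Icc (0 : ℝ) T, ∀ s ∈ Icc (0 : ℝ) T, ∀ i j : Fin d,
    ∫ w, B t w i * B s w j ∂P =
      if i = j then (t ^ (2 * H) + s ^ (2 * H) - |t - s| ^ (2 * H)) / 2 else 0
  continuous_paths : ∀ᵐ w ∂P, ContinuousOn (fun t => B t w) (Icc (0 : ℝ) T)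

/-- The partial derivative `∂g/∂x_l` of a function on `ℝ^d`. -/
noncomputable def partialDeriv {d : ℕ} (l : Fin d) (g : EuclideanSpace ℝ (Fin d) → ℝ) :
    EuclideanSpace ℝ (Fin d) → ℝ :=
  fun x => fderiv ℝ g x (EuclideanSpace.single l 1)

/-- The differential operator `D^a = ∂_1^{a_1} ⋯ ∂_d^{a_d}` of a multi-index `a`. -/
noncomputable def multiDeriv {d : ℕ} (a : Fin d → ℕ) (g : EuclideanSpace ℝ (Fin d) → ℝ) :
    EuclideanSpace ℝ (Fin d) → ℝ :=
  (List.finRange d).foldr (fun l h => (partialDeriv l)^[a l] h) g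

/-- `f` is a smooth function with compact support on `[0, T] × ℝ^d`. -/
structure IsTestFunction (T : ℝ) {d : ℕ} (f : ℝ → EuclideanSpace ℝ (Fin d) → ℝ) : Prop where
  smooth : ContDiffOn ℝ ∞ (fun p : ℝ × EuclideanSpace ℝ (Fin d) => f p.1 p.2)
    (Icc (0 : ℝ) T ×ˢ univ)
  compact_support : ∃ K : Set (EuclideanSpace ℝ (Fin d)), IsCompact K ∧
    ∀ s ∈ Icc (0 : ℝ) T, ∀ x, x ∉ K → f s x = 0

/-- The norm `‖f‖ = ess sup_{s ∈ [0, T]} ∫ |f(s, x)| dx` of `L^∞([0, T]; L^1(ℝ^d))`. -/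
noncomputable def normLinftyL1 (T : ℝ) {d : ℕ} (f : ℝ → EuclideanSpace ℝ (Fin d) → ℝ) : ℝ :=
  (essSup (fun s => eLpNorm (f s) 1 volume) (volume.restrict (Icc (0 : ℝ) T))).toReal

/-- The simplex of all `(s_1, …, s_m)` with `θ < s_m < ⋯ < s_1 < t`. -/
def openSimplex (m : ℕ) (θ t : ℝ) : Set (Fin m → ℝ) :=
  {s | StrictAnti s ∧ ∀ j, s j ∈ Ioo θ t}

/-- `H` is smaller than the minimum, over all `n ≥ 1` and all `e ∈ {0, 1}^n`, of
`(n - ½ ∑ e_j) / (n d (2k + 1) - ∑ e_j)`. The denominator is never negative for `d ≥ 1`;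
a quotient whose denominator vanishes counts as `+∞`. -/
def HurstCondition (H : ℝ) (d k : ℕ) : Prop :=
  ∀ n : ℕ, 1 ≤ n → ∀ e : Fin n → ℕ, (∀ j, e j = 0 ∨ e j = 1) →
    0 < (n : ℝ) * d * (2 * k + 1) - ∑ j, (e j : ℝ) →
      H < ((n : ℝ) - 1 / 2 * ∑ j, (e j : ℝ)) / ((n : ℝ) * d * (2 * k + 1) - ∑ j, (e j : ℝ))

/-- The integrand `∏_j D^{a_j} f_j(s_j, B_{s_j}) κ_j(s_j)` along a path `b`, with the weights
`κ_j(s) = (K_H(s, θ) - K_H(s, θ'))^{e_j}`. -/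
noncomputable def weightedIntegrand {d m : ℕ} (H θ' θ : ℝ) (e : Fin m → ℕ)
    (a : Fin m → Fin d → ℕ) (f : Fin m → ℝ → EuclideanSpace ℝ (Fin d) → ℝ)
    (b : ℝ → EuclideanSpace ℝ (Fin d)) (s : Fin m → ℝ) : ℝ :=
  ∏ j, multiDeriv (a j) (f j (s j)) (b (s j)) *
    (volterraKernel H (s j) θ - volterraKernel H (s j) θ') ^ e j

/-!
The estimate reduces to one expectation at a fixed point `s` of the simplex, followed by an explicit
integral over the simplex.

*Fixed `s`.* Fourier inversion in every factor writes `E[∏ D^{α_j} f_j(s_j, B_{s_j})]` as the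
integral of `∏ (2πi ξ_j)^{α_j} 𝓕 f_j(ξ_j)` against the characteristic function of
`(B_{s_1}, …, B_{s_m})`. Since `|𝓕 f_j| ≤ ‖f_j‖_{L¹}`, only the absolute moments of the Gaussian
weight `exp (-2π² Var (∑ ⟨ξ_j, B_{s_j}⟩))` matter (`enorm_integral_prod_multiDeriv_le`). They are
controlled by local nondeterminism, and the point is that its constant must not depend on `m`. For
`H < 1/2` the covariance of fractional Brownian motion is, up to a factor, the Gram matrix of the
functions `(a, b) ↦ 1_{a < s ≤ b} (b - a)^{H - 1}` (with the function for `s = 0` subtracted) in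
`L²(ℝ²)`: the squared distance of two of them is a multiple of `|s - t|^{2H}`. On
the box `[s_j - r_j, s_j) × [s_j, s_j + r_j)` a linear combination only sees its `j`-th term, and
these boxes are disjoint when `r_j` is at most the distance of `s_j` to `0` and to the other points,
so `Var (∑ u_j B_{s_j}) ≥ c ∑ u_j² r_j^{2H}` with the same `c` for all `m`
(`sum_sq_mul_le_norm_sq_crossLp`). This lets half of the quadratic form absorb the polynomial
weight, factor by factor; the remaining Gaussian integral is computed by successive orthogonal
projection (`lintegral_exp_neg_sum_norm_sq_le`). The result is the bound
`C^m ∏ (s_{j-1} - s_j)^{-w}` with `s_0 = t` and `w = d (2k + 1) H < 1` (`lintegral_moment_le`).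

*The kernel.* `|K_H(s, θ) - K_H(s, θ')| ≤ C (θ - θ')^γ (s - θ)^{-ρ}` with `ρ = 1/2 - H + γ`, and `C`
is uniform in `γ` (`exists_abs_volterraKernel_sub_le`).

*The simplex.* The integral of `∏ (s_{j-1} - s_j)^{-w} (s_j - θ)^{-ρ ε_j}` is an iterated Beta
integral, at most `C^m (t - θ)^Q / Γ(Q + 1)` with `Q = m (1 - w) - ρ ∑ ε_j`; the hypothesis on `γ`
says `w + ρ ≤ 1`, hence `Q ≥ 0` at every stage (`lintegral_openSimplex_le`). Legendre's duplication
formula compares `Γ(Q + 1)` with `Γ(2Q + 1)^{1/2}` (`sqrt_Gamma_le`).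
-/

section ofENNReal

open scoped ENNReal

/-! ### An `L²` model of fractional Brownian motion and local nondeterminism -/

/-- The function of the pair `(a, b)` that equals `(b - a) ^ (H - 1)` if the interval `[a, b]`
crosses `s`, in the sense that `a < s ≤ b`, and vanishes otherwise. It is not square-integrable
itself; differences of two such functions are. -/
noncomputable def crossFn (H s : ℝ) (p : ℝ × ℝ) : ℝ :=
  if p.1 < s ∧ s ≤ p.2 then (p.2 - p.1) ^ (H - 1) else 0

lemma measurable_crossFn (H s : ℝ) : Measurable (crossFn H s) := by
  unfold crossFn
  refine Measurable.ite ?_ (by fun_prop) measurable_const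
  exact (measurableSet_lt measurable_fst measurable_const).inter
    (measurableSet_le measurable_const measurable_snd)

lemma lintegral_rpow_Ioi {H : ℝ} (hH : H < 1 / 2) {x : ℝ} (hx : 0 < x) :
    ∫⁻ v in Ioi x, ENNReal.ofReal (v ^ (2 * H - 2)) =
      ENNReal.ofReal (x ^ (2 * H - 1) / (1 - 2 * H)) := by
  rw [← ofReal_integral_eq_lintegral_ofReal (integrableOn_Ioi_rpow_of_lt (by linarith) hx),
    integral_Ioi_rpow_of_lt (by linarith) hx]
  · congr 1
    rw [show 2 * H - 2 + 1 = 2 * H - 1 by ring, ← neg_div_neg_eq, neg_neg]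
    congr 1; ring
  · filter_upwards [ae_restrict_mem measurableSet_Ioi] with v hv
    exact Real.rpow_nonneg (hx.trans hv).le _

lemma lintegral_rpow_Ioo {H : ℝ} (hH0 : 0 < H) (hH : H < 1 / 2) {x : ℝ} (hx : 0 ≤ x) :
    ∫⁻ v in Ioo 0 x, ENNReal.ofReal (v ^ (2 * H - 1) / (1 - 2 * H)) =
      ENNReal.ofReal (x ^ (2 * H) / (2 * H * (1 - 2 * H))) := by
  have hi : IntegrableOn (fun v : ℝ => v ^ (2 * H - 1) / (1 - 2 * H)) (Ioo 0 x) := by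
    rw [← integrableOn_Ioc_iff_integrableOn_Ioo,
      ← intervalIntegrable_iff_integrableOn_Ioc_of_le hx]
    exact (intervalIntegral.intervalIntegrable_rpow' (by linarith)).div_const _
  rw [← ofReal_integral_eq_lintegral_ofReal hi, ← integral_Ioc_eq_integral_Ioo,
    ← intervalIntegral.integral_of_le hx, intervalIntegral.integral_div,
    integral_rpow (Or.inl (by linarith))]
  · congr 1
    rw [sub_add_cancel, Real.zero_rpow (by linarith), sub_zero, div_div]
  · filter_upwards [ae_restrict_mem measurableSet_Ioo] with v hv
    exact div_nonneg (Real.rpow_nonneg hv.1.le _) (by linarith)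

/-- The squared distance is supported on the pairs `(a, b)` for which `(a, b]` contains exactly one
of `s` and `t`; the two regions contribute equally. -/
lemma lintegral_crossFn_sub_sq {H : ℝ} (hH0 : 0 < H) (hH : H < 1 / 2) {s t : ℝ} (hst : s ≤ t) :
    ∫⁻ p, ENNReal.ofReal ((crossFn H s p - crossFn H t p) ^ 2) =
      ENNReal.ofReal ((t - s) ^ (2 * H) / (H * (1 - 2 * H))) := by
  set g : ℝ → ℝ≥0∞ := fun v => ENNReal.ofReal (v ^ (2 * H - 2)) with hg
  have hgm : Measurable g := by fun_prop
  set A : Set (ℝ × ℝ) := {p | p.1 < s ∧ s ≤ p.2 ∧ p.2 < t} with hA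
  set B : Set (ℝ × ℝ) := {p | s ≤ p.1 ∧ p.1 < t ∧ t ≤ p.2} with hB
  have hAm : MeasurableSet A := (measurableSet_lt measurable_fst measurable_const).inter
    ((measurableSet_le measurable_const measurable_snd).inter
      (measurableSet_lt measurable_snd measurable_const))
  have hBm : MeasurableSet B := (measurableSet_le measurable_const measurable_fst).inter
    ((measurableSet_lt measurable_fst measurable_const).inter
      (measurableSet_le measurable_const measurable_snd))
  have key : ∀ p : ℝ × ℝ, ENNReal.ofReal ((crossFn H s p - crossFn H t p) ^ 2) =
      A.indicator (fun p => g (p.2 - p.1)) p + B.indicator (fun p => g (p.2 - p.1)) p := by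
    rintro ⟨a, b⟩
    have sq : a < b → ((b - a) ^ (H - 1)) ^ 2 = (b - a) ^ (2 * H - 2) := fun h => by
      rw [← Real.rpow_natCast, ← Real.rpow_mul (by linarith)]; congr 1; push_cast; ring
    simp only [crossFn, Set.indicator, hA, hB, Set.mem_ofPred_eq, hg]
    by_cases h1 : a < s ∧ s ≤ b <;> by_cases h2 : a < t ∧ t ≤ b
    · rw [if_pos h1, if_pos h2, if_neg (by grind), if_neg (by grind)]; simp
    · rw [if_pos h1, if_neg h2, if_pos (by grind), if_neg (by grind), sub_zero,
        sq (by linarith), add_zero]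
    · rw [if_neg h1, if_pos h2, if_neg (by grind), if_pos (by grind), zero_sub, neg_sq,
        sq (by linarith), zero_add]
    · rw [if_neg h1, if_neg h2, if_neg (by grind), if_neg (by grind)]; simp
  have hts : 0 ≤ t - s := by linarith
  have hgm2 : Measurable fun p : ℝ × ℝ => g (p.2 - p.1) := by fun_prop
  have e1 : ∫⁻ p, A.indicator (fun p => g (p.2 - p.1)) p =
      ENNReal.ofReal ((t - s) ^ (2 * H) / (2 * H * (1 - 2 * H))) := by
    rw [Measure.volume_eq_prod, lintegral_prod_symm' _ (hgm2.indicator hAm),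
      ← lintegral_rpow_Ioo hH0 hH hts]
    rw [← lintegral_indicator measurableSet_Ioo]
    rw [← lintegral_sub_right_eq_self (fun v => (Ioo 0 (t - s)).indicator (fun v : ℝ =>
      ENNReal.ofReal (v ^ (2 * H - 1) / (1 - 2 * H))) v) s]
    refine lintegral_congr_ae ?_
    filter_upwards [compl_mem_ae_iff.2 (measure_singleton s)] with b hb
    have hb : b ≠ s := hb
    by_cases h : s < b ∧ b < t
    · rw [indicator_of_mem (by constructor <;> linarith), ← lintegral_rpow_Ioi hH (by linarith),
        ← lintegral_indicator measurableSet_Ioi,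
        ← lintegral_sub_left_eq_self (fun v => (Ioi (b - s)).indicator (fun v : ℝ =>
          ENNReal.ofReal (v ^ (2 * H - 2))) v) b]
      refine lintegral_congr fun a => ?_
      simp only [Set.indicator, hA, Set.mem_ofPred_eq, mem_Ioi, hg]
      congr 1
      simp only [eq_iff_iff]; constructor
      · rintro ⟨h1, -⟩; linarith
      · intro h1; exact ⟨by linarith, h.1.le, h.2⟩
    · rw [indicator_of_notMem (by rintro ⟨h1, h2⟩; exact h ⟨by linarith, by linarith⟩),
        lintegral_eq_zero_of_ae_eq_zero]
      refine Filter.Eventually.of_forall fun a => ?_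
      refine indicator_of_notMem ?_ _
      rintro ⟨-, h1, h2⟩
      exact h ⟨lt_of_le_of_ne h1 hb.symm, h2⟩
  have e2 : ∫⁻ p, B.indicator (fun p => g (p.2 - p.1)) p =
      ENNReal.ofReal ((t - s) ^ (2 * H) / (2 * H * (1 - 2 * H))) := by
    rw [Measure.volume_eq_prod, lintegral_prod _ (hgm2.indicator hBm).aemeasurable,
      ← lintegral_rpow_Ioo hH0 hH hts]
    rw [← lintegral_indicator measurableSet_Ioo]
    rw [← lintegral_sub_left_eq_self (fun v => (Ioo 0 (t - s)).indicator (fun v : ℝ =>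
      ENNReal.ofReal (v ^ (2 * H - 1) / (1 - 2 * H))) v) t]
    refine lintegral_congr_ae ?_
    filter_upwards [compl_mem_ae_iff.2 (measure_singleton s)] with a ha
    have ha : a ≠ s := ha
    by_cases h : s < a ∧ a < t
    · rw [indicator_of_mem (by constructor <;> linarith), ← lintegral_rpow_Ioi hH (by linarith),
        setLIntegral_congr Ioi_ae_eq_Ici,
        ← lintegral_indicator measurableSet_Ici,
        ← lintegral_sub_right_eq_self (fun v => (Ici (t - a)).indicator (fun v : ℝ =>
          ENNReal.ofReal (v ^ (2 * H - 2))) v) a]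
      refine lintegral_congr fun b => ?_
      simp only [Set.indicator, hB, Set.mem_ofPred_eq, mem_Ici, hg]
      congr 1
      simp only [eq_iff_iff]; constructor
      · rintro ⟨-, -, h1⟩; linarith
      · intro h1; exact ⟨h.1.le, h.2, by linarith⟩
    · rw [indicator_of_notMem (by rintro ⟨h1, h2⟩; exact h ⟨by linarith, by linarith⟩),
        lintegral_eq_zero_of_ae_eq_zero]
      refine Filter.Eventually.of_forall fun b => ?_
      refine indicator_of_notMem ?_ _
      rintro ⟨h1, h2, -⟩
      exact h ⟨lt_of_le_of_ne h1 ha.symm, h2⟩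
  simp_rw [key]
  have h0 : 0 ≤ (t - s) ^ (2 * H) / (2 * H * (1 - 2 * H)) :=
    div_nonneg (by positivity) (by nlinarith)
  rw [lintegral_add_left (hgm2.indicator hAm), e1, e2, ← ENNReal.ofReal_add h0 h0]
  congr 1; field_simp; ring

lemma memLp_crossFn_sub {H : ℝ} (hH0 : 0 < H) (hH : H < 1 / 2) (s t : ℝ) :
    MemLp (fun p => crossFn H s p - crossFn H t p) 2 := by
  have hm : Measurable fun p => crossFn H s p - crossFn H t p :=
    (measurable_crossFn H s).sub (measurable_crossFn H t)
  refine (memLp_two_iff_integrable_sq hm.aestronglyMeasurable).2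
    ⟨(hm.pow_const 2).aestronglyMeasurable, ?_⟩
  rw [hasFiniteIntegral_iff_ofReal (Filter.Eventually.of_forall fun _ => sq_nonneg _)]
  rcases le_total s t with h | h
  · rw [lintegral_crossFn_sub_sq hH0 hH h]; exact ENNReal.ofReal_lt_top
  · simp_rw [sub_sq_comm (crossFn H s _)]
    rw [lintegral_crossFn_sub_sq hH0 hH h]; exact ENNReal.ofReal_lt_top

lemma norm_toLp_sq_eq {α : Type*} [MeasurableSpace α] {μ : Measure α} {f : α → ℝ}
    (hf : MemLp f 2 μ) : ‖hf.toLp f‖ ^ 2 = ∫ x, f x ^ 2 ∂μ := by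
  rw [← real_inner_self_eq_norm_sq, L2.inner_def]
  refine integral_congr_ae ?_
  filter_upwards [hf.coeFn_toLp] with x hx
  simp [hx, sq]

lemma integral_crossFn_sub_sq {H : ℝ} (hH0 : 0 < H) (hH : H < 1 / 2) (s t : ℝ) :
    ∫ p, (crossFn H s p - crossFn H t p) ^ 2 = |s - t| ^ (2 * H) / (H * (1 - 2 * H)) := by
  have hm : Measurable fun p => crossFn H s p - crossFn H t p :=
    (measurable_crossFn H s).sub (measurable_crossFn H t)
  rw [integral_eq_lintegral_of_nonneg_ae (Filter.Eventually.of_forall fun _ => sq_nonneg _)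
    (hm.pow_const 2).aestronglyMeasurable]
  have h1 : 0 ≤ |s - t| ^ (2 * H) / (H * (1 - 2 * H)) :=
    div_nonneg (by positivity) (by nlinarith)
  rcases le_total s t with h | h
  · rw [lintegral_crossFn_sub_sq hH0 hH h, ← abs_of_nonneg (sub_nonneg.2 h), abs_sub_comm t s,
      ENNReal.toReal_ofReal h1]
  · simp_rw [sub_sq_comm (crossFn H s _)]
    rw [abs_of_nonneg (sub_nonneg.2 h)] at h1 ⊢
    rw [lintegral_crossFn_sub_sq hH0 hH h, ENNReal.toReal_ofReal h1]

/-- The vectors of `L²(ℝ²)` representing the fractional Brownian motion, up to normalization; the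
function at `s = 0` is subtracted to make them square-integrable and to start the process at `0`. -/
noncomputable def crossLp {H : ℝ} (hH0 : 0 < H) (hH : H < 1 / 2) (s : ℝ) :
    Lp ℝ 2 (volume : Measure (ℝ × ℝ)) :=
  (memLp_crossFn_sub hH0 hH s 0).toLp _

/-- The Gram matrix, by polarization of `integral_crossFn_sub_sq`. -/
lemma inner_crossLp {H : ℝ} (hH0 : 0 < H) (hH : H < 1 / 2) (s t : ℝ) :
    inner ℝ (crossLp hH0 hH s) (crossLp hH0 hH t) =
      (H * (1 - 2 * H))⁻¹ * ((|s| ^ (2 * H) + |t| ^ (2 * H) - |s - t| ^ (2 * H)) / 2) := by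
  have h1 : ∀ s, ‖crossLp hH0 hH s‖ ^ 2 = |s| ^ (2 * H) / (H * (1 - 2 * H)) := fun s => by
    rw [crossLp, norm_toLp_sq_eq, integral_crossFn_sub_sq hH0 hH, sub_zero]
  have h2 : ‖crossLp hH0 hH s - crossLp hH0 hH t‖ ^ 2 =
      |s - t| ^ (2 * H) / (H * (1 - 2 * H)) := by
    rw [crossLp, crossLp, ← MemLp.toLp_sub, norm_toLp_sq_eq, ← integral_crossFn_sub_sq hH0 hH]
    simp
  have h3 := norm_sub_sq_real (crossLp hH0 hH s) (crossLp hH0 hH t)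
  rw [h1, h1, h2] at h3
  rw [div_eq_inv_mul, div_eq_inv_mul, div_eq_inv_mul] at h3
  linarith

/-- Local nondeterminism with a constant that does not depend on the number of points:
the squared norm controls all coefficients at once, because the pairs `a < b` with
`s_j - r_j ≤ a < s_j ≤ b < s_j + r_j` form pairwise disjoint sets, on the `j`-th of which the linear
combination equals `u_j (b - a) ^ (H - 1)`. -/
lemma sum_sq_mul_le_norm_sq_crossLp {H : ℝ} (hH0 : 0 < H) (hH : H < 1 / 2) {m : ℕ}
    (s r u : Fin m → ℝ) (hr : ∀ j, 0 ≤ r j) (hrs : ∀ j, r j ≤ s j)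
    (hrr : ∀ i j, i ≠ j → r j ≤ |s i - s j|) :
    2 ^ (2 * H - 2) * ∑ j, u j ^ 2 * r j ^ (2 * H) ≤ ‖∑ j, u j • crossLp hH0 hH (s j)‖ ^ 2 := by
  have hF : MemLp (fun p => ∑ j, u j * (crossFn H (s j) p - crossFn H 0 p)) 2 :=
    memLp_finsetSum _ fun j _ => (memLp_crossFn_sub hH0 hH (s j) 0).const_mul (u j)
  have hFe : ∑ j, u j • crossLp hH0 hH (s j) = hF.toLp _ := by
    refine Lp.ext ?_
    have h2 : ∀ j, (u j • crossLp hH0 hH (s j) : Lp ℝ 2 (volume : Measure (ℝ × ℝ))) =ᵐ[volume]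
        fun p => u j * (crossFn H (s j) p - crossFn H 0 p) := fun j => by
      filter_upwards [Lp.coeFn_smul (u j) (crossLp hH0 hH (s j)),
        (memLp_crossFn_sub hH0 hH (s j) 0).coeFn_toLp] with p h3 h4
      rw [h3, Pi.smul_apply, crossLp, h4, smul_eq_mul]
    filter_upwards [Lp.coeFn_finsetSum Finset.univ fun j => u j • crossLp hH0 hH (s j),
      hF.coeFn_toLp, ae_all_iff.2 h2] with p h3 h4 h5
    rw [h3, h4, Finset.sum_apply]
    exact Finset.sum_congr rfl fun j _ => h5 j
  rw [hFe, norm_toLp_sq_eq]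
  set F : ℝ × ℝ → ℝ := fun p => ∑ j, u j * (crossFn H (s j) p - crossFn H 0 p) with hFdef
  have hFi : Integrable (fun p => F p ^ 2) := hF.integrable_sq
  set box : Fin m → Set (ℝ × ℝ) := fun j => Ico (s j - r j) (s j) ×ˢ Ico (s j) (s j + r j)
    with hbox
  have hbm : ∀ j, MeasurableSet (box j) := fun j => measurableSet_Ico.prod measurableSet_Ico
  have hgap : ∀ i j, s i < s j → r j ≤ s j - s i ∧ r i ≤ s j - s i := fun i j h => by
    have hij : i ≠ j := by rintro rfl; exact lt_irrefl _ h
    have h1 := hrr i j hij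
    have h2 := hrr j i hij.symm
    rw [abs_sub_comm, abs_of_pos (by linarith)] at h1
    rw [abs_of_pos (by linarith)] at h2
    exact ⟨h1, h2⟩
  have hdisj : Pairwise (Function.onFun Disjoint box) := by
    intro i j hij
    refine Set.disjoint_left.2 ?_
    rintro ⟨a, b⟩ ⟨⟨h1, h2⟩, h3, h4⟩ ⟨⟨h5, h6⟩, h7, h8⟩
    simp only at h1 h2 h3 h4 h5 h6 h7 h8
    rcases lt_trichotomy (s i) (s j) with h | h | h
    · linarith [(hgap i j h).2]
    · have := hrr i j hij
      rw [h, sub_self, abs_zero] at this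
      linarith
    · linarith [(hgap j i h).2]
  have hval : ∀ j, ∀ p ∈ box j, F p = u j * (p.2 - p.1) ^ (H - 1) := by
    rintro j ⟨a, b⟩ ⟨⟨h1, h2⟩, h3, h4⟩
    simp only at h1 h2 h3 h4
    -- The box lies in `a ≥ 0`, so the subtracted function vanishes on it.
    have h0 : crossFn H 0 (a, b) = 0 :=
      if_neg (by rintro ⟨h5, -⟩; simp only at h5; linarith [hrs j])
    rw [hFdef]
    simp only [h0, sub_zero]
    rw [Finset.sum_eq_single j]
    · rw [crossFn, if_pos ⟨h2, h3⟩]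
    · intro i _ hij
      rw [crossFn, if_neg, mul_zero]
      rintro ⟨h5, h6⟩
      simp only at h5 h6
      rcases lt_trichotomy (s i) (s j) with h | h | h
      · linarith [(hgap i j h).1]
      · have := hrr i j hij
        rw [h, sub_self, abs_zero] at this
        linarith
      · linarith [(hgap j i h).2]
    · simp
  have hone : ∀ j, 2 ^ (2 * H - 2) * (u j ^ 2 * r j ^ (2 * H)) ≤ ∫ p in box j, F p ^ 2 := by
    intro j
    have hvol : volume.real (box j) = r j * r j := by
      rw [measureReal_def, hbox, Measure.volume_eq_prod, Measure.prod_prod, Real.volume_Ico,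
        Real.volume_Ico, ENNReal.toReal_mul, ENNReal.toReal_ofReal (by linarith [hr j]),
        ENNReal.toReal_ofReal (by linarith [hr j])]
      ring
    rcases (hr j).eq_or_lt with h0 | h0
    · rw [← h0, Real.zero_rpow (by linarith), mul_zero, mul_zero]
      exact integral_nonneg fun _ => sq_nonneg _
    -- `b - a ≤ 2 r_j` on the box, and the exponent is negative.
    have hc : ∀ p ∈ box j, u j ^ 2 * (2 * r j) ^ (2 * H - 2) ≤ F p ^ 2 := by
      intro p hp
      rw [hval j p hp, mul_pow]
      obtain ⟨⟨h1, h2⟩, h3, h4⟩ := hp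
      rw [← Real.rpow_natCast ((p.2 - p.1) ^ (H - 1)), ← Real.rpow_mul (by linarith),
        show (H - 1) * ((2 : ℕ) : ℝ) = 2 * H - 2 by push_cast; ring]
      exact mul_le_mul_of_nonneg_left
        (Real.rpow_le_rpow_of_nonpos (by linarith) (by linarith) (by linarith)) (sq_nonneg _)
    have hle := setIntegral_mono_on (integrableOn_const (μ := (volume : Measure (ℝ × ℝ)))
      (s := box j) (C := u j ^ 2 * (2 * r j) ^ (2 * H - 2)) ?_) hFi.integrableOn (hbm j) hc
    · rw [setIntegral_const, hvol, smul_eq_mul] at hle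
      refine le_trans (le_of_eq ?_) hle
      rw [Real.mul_rpow (by norm_num) h0.le, show 2 * H = (2 * H - 2) + 2 by ring,
        Real.rpow_add h0, Real.rpow_two, add_sub_cancel_right]
      ring
    · rw [hbox, Measure.volume_eq_prod, Measure.prod_prod, Real.volume_Ico, Real.volume_Ico]
      exact ENNReal.mul_ne_top ENNReal.ofReal_ne_top ENNReal.ofReal_ne_top
  calc 2 ^ (2 * H - 2) * ∑ j, u j ^ 2 * r j ^ (2 * H)
      = ∑ j, 2 ^ (2 * H - 2) * (u j ^ 2 * r j ^ (2 * H)) := Finset.mul_sum _ _ _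
    _ ≤ ∑ j, ∫ p in box j, F p ^ 2 := Finset.sum_le_sum fun j _ => hone j
    _ = ∫ p in ⋃ j, box j, F p ^ 2 :=
        (integral_iUnion_fintype hbm hdisj fun j => hFi.integrableOn).symm
    _ ≤ ∫ p, F p ^ 2 :=
        setIntegral_le_integral hFi (Filter.Eventually.of_forall fun _ => sq_nonneg _)

/-! ### Gaussian integrals in triangular coordinates -/

lemma lintegral_exp_neg_mul_sq_norm (d : ℕ) {b : ℝ} (hb : 0 < b) :
    ∫⁻ x : EuclideanSpace ℝ (Fin d), ENNReal.ofReal (Real.exp (-b * ‖x‖ ^ 2)) =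
      ENNReal.ofReal ((Real.pi / b) ^ ((d : ℝ) / 2)) := by
  have h := GaussianFourier.integral_rexp_neg_mul_sq_norm (V := EuclideanSpace ℝ (Fin d)) hb
  rw [finrank_euclideanSpace_fin] at h
  have hi : Integrable fun x : EuclideanSpace ℝ (Fin d) => Real.exp (-b * ‖x‖ ^ 2) := by
    by_contra hc
    rw [integral_undef hc] at h
    exact (Real.rpow_pos_of_pos (div_pos Real.pi_pos hb) _).ne h
  rw [← ofReal_integral_eq_lintegral_ofReal hi
    (Filter.Eventually.of_forall fun _ => (Real.exp_pos _).le), h]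

/-- Gaussian integral over `m` vectors of `ℝ^d`. The hypothesis says that `a j` is at most the
squared distance of `X j` to the span of the later vectors. Integrating out the first vector, after
completing the square with the orthogonal projection of `X 0` onto the span of the other vectors,
leaves the same integral for the remaining vectors. -/
lemma lintegral_exp_neg_sum_norm_sq_le {V : Type*} [NormedAddCommGroup V] [InnerProductSpace ℝ V]
    (d : ℕ) {c : ℝ} (hc : 0 < c) : ∀ (m : ℕ) (X : Fin m → V) (a : Fin m → ℝ) (_ : ∀ j, 0 < a j)
    (_ : ∀ (j : Fin m) (v : Fin m → ℝ), (∀ i < j, v i = 0) →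
      v j ^ 2 * a j ≤ ‖∑ i, v i • X i‖ ^ 2),
    ∫⁻ u : Fin m → EuclideanSpace ℝ (Fin d),
      ENNReal.ofReal (Real.exp (-c * ∑ l, ‖∑ j, u j l • X j‖ ^ 2)) ≤
      ∏ j, ENNReal.ofReal ((Real.pi / (c * a j)) ^ ((d : ℝ) / 2)) := by
  intro m
  induction m with
  | zero => intro X a _ _; simp [lintegral_unique, volume_pi]
  | succ m ih =>
    intro X a ha h
    set Y : Fin m → V := fun j => X j.succ with hY
    have htail := ih Y (fun j => a j.succ) (fun j => ha _) (by
      intro j v hv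
      have := h j.succ (Fin.cons 0 v) (by
        intro i hi
        refine Fin.cases ?_ (fun i hi => ?_) i hi
        · simp
        · simpa using hv i (by simpa using hi))
      simpa [Fin.sum_univ_succ] using this)
    set K : Submodule ℝ V := Submodule.span ℝ (Set.range Y) with hK
    have : FiniteDimensional ℝ K := FiniteDimensional.span_of_finite ℝ (Set.finite_range Y)
    obtain ⟨b, hb⟩ : ∃ b : Fin m → ℝ, ∑ j, b j • Y j = K.starProjection (X 0) := by
      have : K.starProjection (X 0) ∈ Submodule.span ℝ (Set.range Y) :=
        K.starProjection_apply_mem _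
      exact (Submodule.mem_span_range_iff_exists_fun ℝ).1 this
    set q := X 0 - K.starProjection (X 0) with hq
    have hq0 : a 0 ≤ ‖q‖ ^ 2 := by
      have := h 0 (Fin.cons 1 fun j => -b j) (by intro i hi; exact absurd hi (by simp))
      simpa [Fin.sum_univ_succ, hq, ← hb, sub_eq_add_neg] using this
    have horth : ∀ y ∈ K, inner ℝ q y = 0 := fun y hy =>
      (K.mem_orthogonal' _).1 (K.sub_starProjection_mem_orthogonal (X 0)) y hy
    have hsq : ∀ (x : ℝ) (v : Fin m → ℝ), ‖x • X 0 + ∑ j, v j • Y j‖ ^ 2 =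
        x ^ 2 * ‖q‖ ^ 2 + ‖∑ j, (v j + x * b j) • Y j‖ ^ 2 := by
      intro x v
      have e1 : x • X 0 + ∑ j, v j • Y j = x • q + ∑ j, (v j + x * b j) • Y j := by
        simp_rw [add_smul, Finset.sum_add_distrib, mul_smul, ← Finset.smul_sum, hb, hq, smul_sub]
        abel
      have hmem : ∑ j, (v j + x * b j) • Y j ∈ K :=
        K.sum_mem fun j _ => K.smul_mem _ (Submodule.subset_span ⟨j, rfl⟩)
      rw [e1, norm_add_sq_real, inner_smul_left, horth _ hmem, norm_smul, mul_pow]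
      simp
    set G : (Fin m → EuclideanSpace ℝ (Fin d)) → ℝ≥0∞ := fun u =>
      ENNReal.ofReal (Real.exp (-c * ∑ l, ‖∑ j, u j l • Y j‖ ^ 2)) with hG
    rw [← ((volume_preserving_piFinSuccAbove (fun _ => EuclideanSpace ℝ (Fin d)) 0).symm
      _).lintegral_comp_emb (MeasurableEquiv.measurableEmbedding _), Measure.volume_eq_prod]
    rw [lintegral_prod _ (by
      refine Measurable.aemeasurable ?_
      refine ENNReal.measurable_ofReal.comp (Real.measurable_exp.comp ?_)
      refine Continuous.measurable ?_
      simp only [MeasurableEquiv.piFinSuccAbove_symm_apply, Fin.insertNthEquiv_zero,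
        Fin.consEquiv_apply, Fin.sum_univ_succ]
      fun_prop)]
    have hinner : ∀ x : EuclideanSpace ℝ (Fin d), ∀ v : Fin m → EuclideanSpace ℝ (Fin d),
        ENNReal.ofReal (Real.exp (-c * ∑ l, ‖∑ j,
          (MeasurableEquiv.piFinSuccAbove (fun _ => EuclideanSpace ℝ (Fin d)) 0).symm (x, v) j l
            • X j‖ ^ 2)) =
        ENNReal.ofReal (Real.exp (-(c * ‖q‖ ^ 2) * ‖x‖ ^ 2)) * G (v + fun j => b j • x) := by
      intro x v
      rw [hG, ← ENNReal.ofReal_mul (Real.exp_pos _).le, ← Real.exp_add]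
      congr 2
      simp only [MeasurableEquiv.piFinSuccAbove_symm_apply, Fin.insertNthEquiv_zero,
        Fin.consEquiv_apply, Fin.sum_univ_succ, Fin.cons_zero, Fin.cons_succ]
      rw [EuclideanSpace.real_norm_sq_eq]
      simp only [Pi.add_apply, PiLp.add_apply, PiLp.smul_apply, smul_eq_mul]
      have : ∀ l, ‖x l • X 0 + ∑ j, v j l • X (Fin.succ j)‖ ^ 2 =
        x l ^ 2 * ‖q‖ ^ 2 + ‖∑ j, (v j l + b j * x l) • Y j‖ ^ 2 := fun l =>
          (hsq (x l) fun j => v j l).trans (by simp_rw [mul_comm (x l)])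
      rw [Finset.sum_congr rfl fun l _ => this l, Finset.sum_add_distrib, ← Finset.sum_mul]
      ring
    simp_rw [hinner]
    have hq1 : 0 < ‖q‖ ^ 2 := (ha 0).trans_le hq0
    have hGm : Measurable G := by
      refine ENNReal.measurable_ofReal.comp (Real.measurable_exp.comp ?_)
      exact Continuous.measurable (by fun_prop)
    calc ∫⁻ x : EuclideanSpace ℝ (Fin d), ∫⁻ v : Fin m → EuclideanSpace ℝ (Fin d),
          ENNReal.ofReal (Real.exp (-(c * ‖q‖ ^ 2) * ‖x‖ ^ 2)) * G (v + fun j => b j • x)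
        = ∫⁻ x : EuclideanSpace ℝ (Fin d),
            ENNReal.ofReal (Real.exp (-(c * ‖q‖ ^ 2) * ‖x‖ ^ 2)) * ∫⁻ v, G v := by
          refine lintegral_congr fun x => ?_
          rw [lintegral_const_mul' _ _ ENNReal.ofReal_ne_top,
            lintegral_add_right_eq_self G]
      _ = ENNReal.ofReal ((Real.pi / (c * ‖q‖ ^ 2)) ^ ((d : ℝ) / 2)) * ∫⁻ v, G v := by
          rw [lintegral_mul_const _ (by fun_prop), lintegral_exp_neg_mul_sq_norm d (mul_pos hc hq1)]
      _ ≤ _ := by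
          rw [Fin.prod_univ_succ]
          refine mul_le_mul' (ENNReal.ofReal_le_ofReal ?_) htail
          have := Real.pi_pos
          have := ha 0
          gcongr

/-! ### Gaps of a point of the simplex -/

/-- The distance from `s j` to its predecessor in `t, s 0, s 1, …`, where `s` is decreasing. -/
def upGap {m : ℕ} (t : ℝ) (s : Fin m → ℝ) (j : Fin m) : ℝ :=
  (Fin.cons t s : Fin (m + 1) → ℝ) j.castSucc - s j

/-- The distance from `s j` to its successor in `s 0, …, s (m - 1), 0`. -/
def lowGap {m : ℕ} (s : Fin m → ℝ) (j : Fin m) : ℝ :=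
  s j - (Fin.snoc s 0 : Fin (m + 1) → ℝ) j.succ

lemma lowGap_castSucc {n : ℕ} (t : ℝ) (s : Fin (n + 1) → ℝ) (j : Fin n) :
    lowGap s j.castSucc = upGap t s j.succ := by
  rw [lowGap, upGap, Fin.succ_castSucc, Fin.snoc_castSucc, ← Fin.succ_castSucc, Fin.cons_succ]

lemma lowGap_last {n : ℕ} (s : Fin (n + 1) → ℝ) : lowGap s (Fin.last n) = s (Fin.last n) := by
  rw [lowGap, Fin.succ_last, Fin.snoc_last, sub_zero]

lemma upGap_zero {n : ℕ} (t : ℝ) (s : Fin (n + 1) → ℝ) : upGap t s 0 = t - s 0 := by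
  simp [upGap]

lemma upGap_cons_succ {n : ℕ} (t x : ℝ) (s : Fin n → ℝ) (j : Fin n) :
    upGap t (Fin.cons x s : Fin (n + 1) → ℝ) j.succ = upGap x s j := by
  rw [upGap, upGap, ← Fin.succ_castSucc, Fin.cons_succ, Fin.cons_succ]

section gaps

variable {n : ℕ} {θ t : ℝ} {s : Fin (n + 1) → ℝ}

lemma upGap_pos (hs : s ∈ openSimplex (n + 1) θ t) (j : Fin (n + 1)) : 0 < upGap t s j := by
  refine Fin.cases ?_ (fun j => ?_) j
  · rw [upGap_zero]; linarith [(hs.2 0).2]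
  · rw [← lowGap_castSucc, lowGap, Fin.succ_castSucc, Fin.snoc_castSucc]
    linarith [hs.1 (show j.castSucc < j.succ from Fin.castSucc_lt_succ)]

lemma lowGap_pos (hθ : 0 ≤ θ) (hs : s ∈ openSimplex (n + 1) θ t) (j : Fin (n + 1)) :
    0 < lowGap s j := by
  refine Fin.lastCases ?_ (fun j => ?_) j
  · rw [lowGap_last]; linarith [(hs.2 (Fin.last n)).1]
  · rw [lowGap_castSucc t]; exact upGap_pos hs _

lemma lowGap_le (hθ : 0 ≤ θ) (hs : s ∈ openSimplex (n + 1) θ t) (j : Fin (n + 1)) :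
    lowGap s j ≤ s j := by
  refine Fin.lastCases ?_ (fun j => ?_) j
  · rw [lowGap_last]
  · rw [lowGap, Fin.succ_castSucc, Fin.snoc_castSucc]; linarith [(hs.2 j.succ).1]

lemma upGap_le (hθ : 0 ≤ θ) (hs : s ∈ openSimplex (n + 1) θ t) (j : Fin (n + 1)) :
    upGap t s j ≤ t := by
  refine Fin.cases ?_ (fun j => ?_) j
  · rw [upGap_zero]; linarith [(hs.2 0).1]
  · rw [← lowGap_castSucc]; linarith [lowGap_le hθ hs j.castSucc, (hs.2 j.castSucc).2]

lemma upGap_le_sub (hs : s ∈ openSimplex (n + 1) θ t) {i j : Fin (n + 1)} (hij : i < j) :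
    upGap t s j ≤ s i - s j := by
  revert hij
  refine Fin.cases (fun h => absurd h (by simp)) (fun j h => ?_) j
  rw [← lowGap_castSucc, lowGap, Fin.succ_castSucc, Fin.snoc_castSucc]
  linarith [hs.1.antitone (Fin.le_castSucc_iff.2 h)]

lemma lowGap_le_sub (hs : s ∈ openSimplex (n + 1) θ t) {i j : Fin (n + 1)} (hij : j < i) :
    lowGap s j ≤ s j - s i := by
  revert hij
  refine Fin.lastCases (fun h => absurd h (by simp [Fin.le_last])) (fun j h => ?_) j
  rw [lowGap, Fin.succ_castSucc, Fin.snoc_castSucc]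
  linarith [hs.1.antitone (Fin.castSucc_lt_iff_succ_le.1 h)]

end gaps

/-- `s ↦ fbmVec s` embeds `[0, ∞)` into a Hilbert space such that the Gram matrix is the covariance
of the fractional Brownian motion. -/
noncomputable def fbmVec {H : ℝ} (hH0 : 0 < H) (hH : H < 1 / 2) (s : ℝ) :
    Lp ℝ 2 (volume : Measure (ℝ × ℝ)) :=
  Real.sqrt (H * (1 - 2 * H)) • crossLp hH0 hH s

lemma inner_fbmVec {H : ℝ} (hH0 : 0 < H) (hH : H < 1 / 2) {s t : ℝ} (hs : 0 ≤ s) (ht : 0 ≤ t) :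
    inner ℝ (fbmVec hH0 hH s) (fbmVec hH0 hH t) =
      (s ^ (2 * H) + t ^ (2 * H) - |s - t| ^ (2 * H)) / 2 := by
  have h : 0 < H * (1 - 2 * H) := by nlinarith
  rw [fbmVec, fbmVec, real_inner_smul_left, real_inner_smul_right, inner_crossLp, ← mul_assoc,
    Real.mul_self_sqrt h.le, mul_inv_cancel_left₀ h.ne', abs_of_nonneg hs, abs_of_nonneg ht]

/-- The constant, independent of the number of points, in the local nondeterminism of fractional
Brownian motion. -/
noncomputable def lndConst (H : ℝ) : ℝ := H * (1 - 2 * H) * 2 ^ (2 * H - 2)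

lemma lndConst_pos {H : ℝ} (hH0 : 0 < H) (hH : H < 1 / 2) : 0 < lndConst H :=
  mul_pos (by nlinarith) (by positivity)

lemma lndConst_mul_sum_le {H : ℝ} (hH0 : 0 < H) (hH : H < 1 / 2) {m : ℕ}
    (s r u : Fin m → ℝ) (hr : ∀ j, 0 ≤ r j) (hrs : ∀ j, r j ≤ s j)
    (hrr : ∀ i j, i ≠ j → r j ≤ |s i - s j|) :
    lndConst H * ∑ j, u j ^ 2 * r j ^ (2 * H) ≤ ‖∑ j, u j • fbmVec hH0 hH (s j)‖ ^ 2 := by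
  have h : 0 < H * (1 - 2 * H) := by nlinarith
  have e : ∑ j, u j • fbmVec hH0 hH (s j) =
      Real.sqrt (H * (1 - 2 * H)) • ∑ j, u j • crossLp hH0 hH (s j) := by
    simp_rw [fbmVec, Finset.smul_sum, smul_comm (Real.sqrt _)]
  rw [e, norm_smul, mul_pow, Real.norm_eq_abs, sq_abs, Real.sq_sqrt h.le, lndConst, mul_assoc]
  exact mul_le_mul_of_nonneg_left (sum_sq_mul_le_norm_sq_crossLp hH0 hH s r u hr hrs hrr) h.le

/-- Monomials of degree at most `k` are absorbed into a Gaussian of arbitrary width, by `x ≤ e^x`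
and completion of the square. -/
lemma pow_le_exp_mul {k a : ℕ} (ha : a ≤ k) {β z : ℝ} (hβ : 0 < β) (hz : 0 ≤ z) :
    (2 * Real.pi * z) ^ a ≤ Real.exp (k ^ 2 * Real.pi ^ 2 / β) * Real.exp (β * z ^ 2) := by
  have hpi := Real.pi_pos
  have h1 : 2 * Real.pi * z ≤ Real.exp (2 * Real.pi * z) := by
    linarith [Real.add_one_le_exp (2 * Real.pi * z)]
  calc (2 * Real.pi * z) ^ a ≤ Real.exp (2 * Real.pi * z) ^ a :=
        pow_le_pow_left₀ (by positivity) h1 a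
    _ = Real.exp (a * (2 * Real.pi * z)) := (Real.exp_nat_mul _ _).symm
    _ ≤ Real.exp (k ^ 2 * Real.pi ^ 2 / β + β * z ^ 2) := by
        refine Real.exp_le_exp.2 ?_
        have h2 : (a : ℝ) * (2 * Real.pi * z) ≤ k * (2 * Real.pi * z) := by gcongr
        have h3 : 0 ≤ (k * Real.pi - β * z) ^ 2 / β := by positivity
        have h4 : (k * Real.pi - β * z) ^ 2 / β =
          k ^ 2 * Real.pi ^ 2 / β + β * z ^ 2 - k * (2 * Real.pi * z) := by field_simp; ring
        linarith
    _ = _ := Real.exp_add _ _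

/-! ### Absolute moments of the Gaussian weight on the frequency side -/

/-- A negative power of the minimum of two bounded numbers is at most a multiple of the product of
their negative powers. -/
lemma rpow_neg_min_le {a b T p q : ℝ} (ha : 0 < a) (hb : 0 < b) (haT : a ≤ T) (hbT : b ≤ T)
    (hT : 1 ≤ T) (hq : 0 ≤ q) (hqp : q ≤ p) :
    (min a b) ^ (-q) ≤ T ^ (2 * p) * (a ^ (-p) * b ^ (-p)) := by
  have hT0 : 0 < T := by linarith
  have hx : 0 < a * b / T ^ 2 := by positivity
  have hab : a * b ≤ min a b * T := by
    rcases le_total a b with h | h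
    · rw [min_eq_left h]; gcongr
    · rw [min_eq_right h, mul_comm a b]; gcongr
  have hxm : a * b / T ^ 2 ≤ min a b := by
    rw [div_le_iff₀ (by positivity)]
    nlinarith [mul_nonneg (lt_min ha hb).le (mul_nonneg hT0.le (sub_nonneg.2 hT))]
  have hx1 : a * b / T ^ 2 ≤ 1 := by
    rw [div_le_one (by positivity), sq]; gcongr
  calc (min a b) ^ (-q) ≤ (a * b / T ^ 2) ^ (-q) :=
        Real.rpow_le_rpow_of_nonpos hx hxm (by linarith)
    _ ≤ (a * b / T ^ 2) ^ (-p) := Real.rpow_le_rpow_of_exponent_ge hx hx1 (by linarith)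
    _ = _ := by
        rw [Real.div_rpow (by positivity) (by positivity), Real.mul_rpow ha.le hb.le,
          Real.rpow_neg (by positivity : 0 ≤ T ^ 2), div_inv_eq_mul, ← Real.rpow_natCast T 2,
          ← Real.rpow_mul hT0.le]
        push_cast; ring

/-- The polynomial weight is absorbed into half of the quadratic form, at the price of a power of
the gaps: the quadratic form dominates `∑ r_j ^ (2 H) |ξ_j|²`, where `r_j` is the smaller of the two
gaps at `s_j`. -/
lemma prod_pow_le_exp {d k n : ℕ} {H : ℝ} (hH0 : 0 < H) (hH : H < 1 / 2) {θ t T : ℝ} (hθ : 0 ≤ θ)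
    (htT : t ≤ T) (hT : 1 ≤ T) {s : Fin (n + 1) → ℝ} (hs : s ∈ openSimplex (n + 1) θ t)
    {α : Fin (n + 1) → Fin d → ℕ} (hα : ∀ j l, α j l ≤ k)
    (ξ : Fin (n + 1) → EuclideanSpace ℝ (Fin d)) :
    ∏ j, ∏ l, (2 * Real.pi * |ξ j l|) ^ α j l ≤
      (∏ j, Real.exp (k ^ 2 * Real.pi ^ 2 / (Real.pi ^ 2 * lndConst H)) ^ d *
        (T ^ (2 * (H * d * k)) * (lowGap s j ^ (-(H * d * k)) * upGap t s j ^ (-(H * d * k))))) *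
      Real.exp (Real.pi ^ 2 * ∑ l, ‖∑ j, ξ j l • fbmVec hH0 hH (s j)‖ ^ 2) := by
  set β := Real.pi ^ 2 * lndConst H with hβ
  have hβ0 : 0 < β := mul_pos (by positivity) (lndConst_pos hH0 hH)
  set K := Real.exp (k ^ 2 * Real.pi ^ 2 / β) with hK
  have hK0 : 0 < K := Real.exp_pos _
  set r : Fin (n + 1) → ℝ := fun j => min (lowGap s j) (upGap t s j) with hr
  have hr0 : ∀ j, 0 < r j := fun j => lt_min (lowGap_pos hθ hs j) (upGap_pos hs j)
  have hone : ∀ j l, (2 * Real.pi * |ξ j l|) ^ α j l ≤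
      K * r j ^ (-(H * α j l)) * Real.exp (β * (ξ j l ^ 2 * r j ^ (2 * H))) := by
    intro j l
    have h1 := pow_le_exp_mul (hα j l) hβ0 (mul_nonneg (abs_nonneg (ξ j l))
      (Real.rpow_nonneg (hr0 j).le H))
    have h2 : (|ξ j l| * r j ^ H) ^ 2 = ξ j l ^ 2 * r j ^ (2 * H) := by
      rw [mul_pow, sq_abs, ← Real.rpow_natCast (r j ^ H), ← Real.rpow_mul (hr0 j).le]
      congr 2; push_cast; ring
    have h3 : (2 * Real.pi * |ξ j l|) ^ α j l =
        (2 * Real.pi * (|ξ j l| * r j ^ H)) ^ α j l * r j ^ (-(H * α j l)) := by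
      rw [← mul_assoc, mul_pow _ (r j ^ H), ← Real.rpow_natCast (r j ^ H),
        ← Real.rpow_mul (hr0 j).le, mul_assoc ((2 * Real.pi * |ξ j l|) ^ α j l),
        ← Real.rpow_add (hr0 j), add_neg_cancel, Real.rpow_zero, mul_one]
    rw [h3, ← h2]
    calc _ ≤ K * Real.exp (β * (|ξ j l| * r j ^ H) ^ 2) * r j ^ (-(H * α j l)) :=
          mul_le_mul_of_nonneg_right h1 (Real.rpow_nonneg (hr0 j).le _)
      _ = _ := by ring
  have hrow : ∀ j, ∏ l, (2 * Real.pi * |ξ j l|) ^ α j l ≤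
      (K ^ d * (T ^ (2 * (H * d * k)) *
        (lowGap s j ^ (-(H * d * k)) * upGap t s j ^ (-(H * d * k))))) *
      Real.exp (β * ∑ l, ξ j l ^ 2 * r j ^ (2 * H)) := by
    intro j
    calc ∏ l, (2 * Real.pi * |ξ j l|) ^ α j l
        ≤ ∏ l, K * r j ^ (-(H * α j l)) * Real.exp (β * (ξ j l ^ 2 * r j ^ (2 * H))) :=
          Finset.prod_le_prod (fun l _ => by positivity) fun l _ => hone j l
      _ = K ^ d * r j ^ (-(H * ∑ l, (α j l : ℝ))) *
            Real.exp (β * ∑ l, ξ j l ^ 2 * r j ^ (2 * H)) := by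
          rw [Finset.prod_mul_distrib, Finset.prod_mul_distrib, Finset.prod_const, ← Real.exp_sum,
            ← Finset.mul_sum, Finset.card_univ, Fintype.card_fin, Finset.mul_sum _ _ H,
            ← Finset.sum_neg_distrib, Real.rpow_sum_of_pos (hr0 j)]
      _ ≤ _ := by
          refine mul_le_mul_of_nonneg_right (mul_le_mul_of_nonneg_left ?_ (by positivity))
            (Real.exp_pos _).le
          refine rpow_neg_min_le (lowGap_pos hθ hs j) (upGap_pos hs j)
            ((lowGap_le hθ hs j).trans ((hs.2 j).2.le.trans htT)) ((upGap_le hθ hs j).trans htT) hT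
            (mul_nonneg hH0.le (Finset.sum_nonneg fun _ _ => Nat.cast_nonneg _)) ?_
          rw [mul_assoc]
          refine mul_le_mul_of_nonneg_left ?_ hH0.le
          calc ∑ l, (α j l : ℝ) ≤ ∑ l : Fin d, (k : ℝ) :=
                Finset.sum_le_sum fun l _ => Nat.cast_le.2 (hα j l)
            _ = d * k := by simp
  have hlnd : ∑ j, β * ∑ l, ξ j l ^ 2 * r j ^ (2 * H) ≤
      Real.pi ^ 2 * ∑ l, ‖∑ j, ξ j l • fbmVec hH0 hH (s j)‖ ^ 2 := by
    rw [← Finset.mul_sum, Finset.sum_comm, hβ, mul_assoc, Finset.mul_sum _ _ (lndConst H)]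
    refine mul_le_mul_of_nonneg_left (Finset.sum_le_sum fun l _ => ?_) (by positivity)
    refine lndConst_mul_sum_le hH0 hH s r (fun j => ξ j l) (fun j => (hr0 j).le)
      (fun j => (min_le_left _ _).trans (lowGap_le hθ hs j)) fun i j hij => ?_
    rcases lt_or_gt_of_ne hij with h | h
    · exact (min_le_right _ _).trans ((upGap_le_sub hs h).trans (le_abs_self _))
    · rw [abs_sub_comm]
      exact (min_le_left _ _).trans ((lowGap_le_sub hs h).trans (le_abs_self _))
  calc ∏ j, ∏ l, (2 * Real.pi * |ξ j l|) ^ α j l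
      ≤ ∏ j, (K ^ d * (T ^ (2 * (H * d * k)) *
        (lowGap s j ^ (-(H * d * k)) * upGap t s j ^ (-(H * d * k))))) *
          Real.exp (β * ∑ l, ξ j l ^ 2 * r j ^ (2 * H)) :=
        Finset.prod_le_prod (fun j _ => Finset.prod_nonneg fun l _ => by positivity)
          fun j _ => hrow j
    _ = (∏ j, K ^ d * (T ^ (2 * (H * d * k)) *
        (lowGap s j ^ (-(H * d * k)) * upGap t s j ^ (-(H * d * k))))) *
          Real.exp (∑ j, β * ∑ l, ξ j l ^ 2 * r j ^ (2 * H)) := by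
        rw [Finset.prod_mul_distrib, Real.exp_sum]
    _ ≤ _ := by
        refine mul_le_mul_of_nonneg_left (Real.exp_le_exp.2 hlnd)
          (Finset.prod_nonneg fun j _ => ?_)
        have := lowGap_pos hθ hs j
        have := upGap_pos hs j
        positivity

/-- The conditional variance of the process at `s j` given the smaller times is at least a multiple
of `lowGap s j ^ (2 * H)`. -/
lemma lowGap_le_dist_sq {n : ℕ} {H : ℝ} (hH0 : 0 < H) (hH : H < 1 / 2) {θ t : ℝ} (hθ : 0 ≤ θ)
    {s : Fin (n + 1) → ℝ} (hs : s ∈ openSimplex (n + 1) θ t) (j : Fin (n + 1))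
    (v : Fin (n + 1) → ℝ) (hv : ∀ i < j, v i = 0) :
    v j ^ 2 * (lndConst H * lowGap s j ^ (2 * H)) ≤ ‖∑ i, v i • fbmVec hH0 hH (s i)‖ ^ 2 := by
  -- The points before `j` have weight zero, so they may be moved away from `s j`.
  set s' : Fin (n + 1) → ℝ := fun i => if i < j then s i + lowGap s j else s i with hs'
  set r : Fin (n + 1) → ℝ := fun i => if i = j then lowGap s j else 0 with hr
  have hl := lowGap_pos hθ hs j
  have h := lndConst_mul_sum_le hH0 hH s' r v (fun i => by simp only [hr]; split_ifs <;> linarith)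
    (fun i => by
      have := (hs.2 i).1
      simp only [hr, hs']
      split_ifs with h1 h2
      · exact absurd h2 (by simp [h1])
      · rw [h1]; exact lowGap_le hθ hs j
      · linarith
      · linarith)
    (fun i i' hi => by
      simp only [hr]
      split_ifs with h1
      · subst h1
        simp only [hs', lt_irrefl, if_false]
        rcases lt_or_gt_of_ne hi with h2 | h2
        · rw [if_pos h2]
          refine le_trans ?_ (le_abs_self _)
          linarith [hs.1 h2]
        · rw [if_neg h2.not_gt, abs_sub_comm]
          exact (lowGap_le_sub hs h2).trans (le_abs_self _)
      · exact abs_nonneg _)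
  rw [Finset.sum_eq_single j] at h
  · calc v j ^ 2 * (lndConst H * lowGap s j ^ (2 * H))
        = lndConst H * (v j ^ 2 * r j ^ (2 * H)) := by simp only [hr, if_true]; ring
      _ ≤ _ := h
      _ = _ := by
        congr 2
        refine Finset.sum_congr rfl fun i _ => ?_
        by_cases hij : i < j
        · rw [hv i hij, zero_smul, zero_smul]
        · simp only [hs', if_neg hij]
  · intro i _ hij
    simp only [hr, if_neg hij]
    rw [Real.zero_rpow (by linarith), mul_zero]
  · simp

/-- The product of the lower gaps is the product of the upper gaps, except that `t - s 0` is
replaced by the last point, which stays away from `0`. -/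
lemma prod_lowGap_rpow_le {n : ℕ} {θ₀ θ t T p : ℝ} (hθ₀ : 0 < θ₀) (hθ : θ₀ ≤ θ) (htT : t ≤ T)
    (hp : 0 ≤ p) {s : Fin (n + 1) → ℝ} (hs : s ∈ openSimplex (n + 1) θ t) :
    ∏ j, lowGap s j ^ (-p) ≤ (T / θ₀) ^ p * ∏ j, upGap t s j ^ (-p) := by
  have h0 : 0 ≤ θ := hθ₀.le.trans hθ
  rw [Fin.prod_univ_castSucc, Fin.prod_univ_succ (fun j => upGap t s j ^ (-p))]
  simp_rw [lowGap_castSucc t]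
  have hP : 0 ≤ ∏ j : Fin n, upGap t s j.succ ^ (-p) :=
    Finset.prod_nonneg fun j _ => Real.rpow_nonneg (upGap_pos hs _).le _
  have h1 : lowGap s (Fin.last n) ^ (-p) ≤ θ₀ ^ (-p) := by
    refine Real.rpow_le_rpow_of_nonpos hθ₀ ?_ (by linarith)
    rw [lowGap_last]; linarith [(hs.2 (Fin.last n)).1]
  have hT : 0 < T := by linarith [upGap_pos hs 0, upGap_le h0 hs 0]
  have h2 : T ^ (-p) ≤ upGap t s 0 ^ (-p) :=
    Real.rpow_le_rpow_of_nonpos (upGap_pos hs 0) ((upGap_le h0 hs 0).trans htT) (by linarith)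
  have h3 : θ₀ ^ (-p) = (T / θ₀) ^ p * T ^ (-p) := by
    rw [Real.div_rpow hT.le hθ₀.le, Real.rpow_neg hθ₀.le, Real.rpow_neg hT.le]
    have := (Real.rpow_pos_of_pos hT p).ne'
    field_simp
  calc _ ≤ (∏ j : Fin n, upGap t s j.succ ^ (-p)) * θ₀ ^ (-p) := by gcongr
    _ = (T / θ₀) ^ p * (T ^ (-p) * ∏ j : Fin n, upGap t s j.succ ^ (-p)) := by rw [h3]; ring
    _ ≤ _ := by gcongr

/-- Absolute moments of the Gaussian weight. Half of the quadratic form absorbs the monomials, at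
the price of both gaps to the power `-(H * d * k)`; the other half is integrated and gives the lower
gaps to the power `-(H * d)`. The lower gaps are then traded for upper gaps. -/
lemma lintegral_moment_le (d k : ℕ) {H : ℝ} (hH0 : 0 < H) (hH : H < 1 / 2) (T : ℝ) {θ₀ : ℝ}
    (hθ₀ : 0 < θ₀) : ∃ C : ℝ, 0 < C ∧ ∀ (n : ℕ) (θ t : ℝ), θ₀ ≤ θ → t ≤ T →
      ∀ s ∈ openSimplex (n + 1) θ t, ∀ α : Fin (n + 1) → Fin d → ℕ, (∀ j l, α j l ≤ k) →
      ∫⁻ ξ : Fin (n + 1) → EuclideanSpace ℝ (Fin d),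
        ENNReal.ofReal ((∏ j, ∏ l, (2 * Real.pi * |ξ j l|) ^ α j l) *
          Real.exp (-(2 * Real.pi ^ 2) * ∑ l, ‖∑ j, ξ j l • fbmVec hH0 hH (s j)‖ ^ 2)) ≤
      ENNReal.ofReal (C ^ (n + 1) * ∏ j, upGap t s j ^ (-(d * (2 * k + 1) * H))) := by
  set T₁ := max T 1 with hT₁
  set p : ℝ := H * d * k with hp
  set q : ℝ := H * d * (k + 1) with hq
  set K := Real.exp (k ^ 2 * Real.pi ^ 2 / (Real.pi ^ 2 * lndConst H)) with hK
  have hK0 : 0 < K := Real.exp_pos _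
  have hl := lndConst_pos hH0 hH
  have hpi := Real.pi_pos
  have hT0 : 0 < T₁ := lt_of_lt_of_le one_pos (le_max_right _ _)
  have hq0 : 0 ≤ q := by positivity
  set A : ℝ := K ^ d * T₁ ^ (2 * p) * (1 / (Real.pi * lndConst H)) ^ ((d : ℝ) / 2) with hA
  have hA0 : 0 < A := by positivity
  set C : ℝ := A * max 1 ((T₁ / θ₀) ^ q) with hC
  have hM : 1 ≤ max 1 ((T₁ / θ₀) ^ q) := le_max_left _ _
  refine ⟨C, by positivity, ?_⟩
  intro n θ t hθ htT s hs α hα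
  have h0 : 0 ≤ θ := hθ₀.le.trans hθ
  have htT₁ : t ≤ T₁ := htT.trans (le_max_left _ _)
  set P : ℝ := ∏ j, K ^ d * (T₁ ^ (2 * p) * (lowGap s j ^ (-p) * upGap t s j ^ (-p))) with hP
  have hP0 : 0 ≤ P := Finset.prod_nonneg fun j _ => by
    have := lowGap_pos h0 hs j
    have := upGap_pos hs j
    positivity
  -- Of the factor `2 π²` in the exponent, one `π²` is spent on the monomials.
  have hpt : ∀ ξ : Fin (n + 1) → EuclideanSpace ℝ (Fin d),
      ENNReal.ofReal ((∏ j, ∏ l, (2 * Real.pi * |ξ j l|) ^ α j l) *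
          Real.exp (-(2 * Real.pi ^ 2) * ∑ l, ‖∑ j, ξ j l • fbmVec hH0 hH (s j)‖ ^ 2)) ≤
      ENNReal.ofReal P * ENNReal.ofReal
        (Real.exp (-(Real.pi ^ 2) * ∑ l, ‖∑ j, ξ j l • fbmVec hH0 hH (s j)‖ ^ 2)) := by
    intro ξ
    rw [← ENNReal.ofReal_mul hP0]
    refine ENNReal.ofReal_le_ofReal ?_
    refine (mul_le_mul_of_nonneg_right (prod_pow_le_exp hH0 hH h0 htT₁ (le_max_right _ _) hs hα ξ)
      (Real.exp_pos _).le).trans (le_of_eq ?_)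
    rw [mul_assoc, ← Real.exp_add]
    congr 2; ring
  refine (lintegral_mono hpt).trans ?_
  rw [lintegral_const_mul' _ _ ENNReal.ofReal_ne_top]
  refine (mul_le_mul_right (lintegral_exp_neg_sum_norm_sq_le d (by positivity : 0 < Real.pi ^ 2)
    (n + 1) (fun j => fbmVec hH0 hH (s j)) (fun j => lndConst H * lowGap s j ^ (2 * H))
    (fun j => mul_pos hl (Real.rpow_pos_of_pos (lowGap_pos h0 hs j) _))
    (fun j v hv => lowGap_le_dist_sq hH0 hH h0 hs j v hv)) _).trans ?_
  rw [← ENNReal.ofReal_prod_of_nonneg (fun j _ => by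
    have := lowGap_pos h0 hs j
    positivity), ← ENNReal.ofReal_mul hP0]
  refine ENNReal.ofReal_le_ofReal ?_
  have hstep : ∀ j, K ^ d * (T₁ ^ (2 * p) * (lowGap s j ^ (-p) * upGap t s j ^ (-p))) *
      (Real.pi / (Real.pi ^ 2 * (lndConst H * lowGap s j ^ (2 * H)))) ^ ((d : ℝ) / 2) =
      A * (lowGap s j ^ (-q) * upGap t s j ^ (-p)) := by
    intro j
    have hj := lowGap_pos h0 hs j
    have e1 : Real.pi / (Real.pi ^ 2 * (lndConst H * lowGap s j ^ (2 * H))) =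
        1 / (Real.pi * lndConst H) * lowGap s j ^ (-(2 * H)) := by
      rw [Real.rpow_neg hj.le]; field_simp
    have e2 : (lowGap s j ^ (-(2 * H))) ^ ((d : ℝ) / 2) = lowGap s j ^ (-(H * d)) := by
      rw [← Real.rpow_mul hj.le]; congr 1; ring
    have e3 : lowGap s j ^ (-q) = lowGap s j ^ (-p) * lowGap s j ^ (-(H * d)) := by
      rw [← Real.rpow_add hj]; congr 1; rw [hq, hp]; ring
    rw [e1, Real.mul_rpow (by positivity) (by positivity), e2, e3, hA]; ring
  rw [hP, ← Finset.prod_mul_distrib, Finset.prod_congr rfl fun j _ => hstep j,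
    Finset.prod_mul_distrib, Finset.prod_const, Finset.card_univ, Fintype.card_fin,
    Finset.prod_mul_distrib, hC, mul_pow A, mul_assoc (A ^ (n + 1))]
  refine mul_le_mul_of_nonneg_left ?_ (by positivity)
  have hu : ∀ j, upGap t s j ^ (-(d * (2 * k + 1) * H)) =
      upGap t s j ^ (-q) * upGap t s j ^ (-p) := fun j => by
    rw [← Real.rpow_add (upGap_pos hs j)]; congr 1; rw [hq, hp]; ring
  rw [Finset.prod_congr rfl fun j _ => hu j, Finset.prod_mul_distrib, ← mul_assoc]
  have hU : ∀ x : ℝ, 0 ≤ ∏ j, upGap t s j ^ x := fun x =>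
    Finset.prod_nonneg fun j _ => Real.rpow_nonneg (upGap_pos hs j).le _
  refine mul_le_mul_of_nonneg_right ?_ (hU _)
  refine (prod_lowGap_rpow_le hθ₀ hθ htT₁ hq0 hs).trans ?_
  refine mul_le_mul_of_nonneg_right ?_ (hU _)
  exact (le_max_right 1 ((T₁ / θ₀) ^ q)).trans (le_self_pow₀ hM n.succ_ne_zero)

/-! ### Fourier representation of derivatives of test functions -/

section fourier

open scoped SchwartzMap FourierTransform LineDeriv

variable {d : ℕ}

local notation "𝔼" => EuclideanSpace ℝ (Fin d)

lemma partialDeriv_eq_lineDerivOp {g : 𝔼 → ℝ} {F : 𝓢(𝔼, ℂ)} (h : ∀ x, F x = g x) (l : Fin d)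
    (x : 𝔼) : (∂_{EuclideanSpace.single l (1 : ℝ)} F) x = (partialDeriv l g x : ℂ) := by
  have hg : g = fun x => Complex.reCLM (F x) := funext fun x => by simp [h]
  have hd : DifferentiableAt ℝ g x := by
    rw [hg]; exact Complex.reCLM.differentiableAt.comp x F.differentiableAt
  have hF : (F : 𝔼 → ℂ) = fun x => Complex.ofRealCLM (g x) := funext fun x => by simp [h]
  rw [SchwartzMap.lineDerivOp_apply_eq_fderiv, hF, partialDeriv]
  rw [show (fun x => Complex.ofRealCLM (g x)) = Complex.ofRealCLM ∘ g from rfl,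
    (Complex.ofRealCLM.hasFDerivAt.comp x hd.hasFDerivAt).fderiv]
  simp

lemma norm_fourier_lineDerivOp (F : 𝓢(𝔼, ℂ)) (l : Fin d) (ξ : 𝔼) :
    ‖𝓕 (∂_{EuclideanSpace.single l (1 : ℝ)} F) ξ‖ = 2 * Real.pi * |ξ l| * ‖𝓕 F ξ‖ := by
  have hT : (inner ℝ · (EuclideanSpace.single l (1 : ℝ)) : 𝔼 → ℝ).HasTemperateGrowth :=
    ((innerSL ℝ).flip (EuclideanSpace.single l (1 : ℝ))).hasTemperateGrowth
  rw [SchwartzMap.fourier_lineDerivOp_eq, smul_apply,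
    SchwartzMap.smulLeftCLM_apply_apply hT, norm_smul, norm_smul, EuclideanSpace.inner_single_right]
  simp [abs_of_pos Real.pi_pos]
  ring

/-- The Schwartz function is complex-valued, the function it represents real-valued. -/
lemma exists_schwartz_iterate (l : Fin d) (n : ℕ) {g : 𝔼 → ℝ} {F : 𝓢(𝔼, ℂ)}
    (h : ∀ x, F x = g x) : ∃ G : 𝓢(𝔼, ℂ), (∀ x, G x = ((partialDeriv l)^[n] g x : ℝ)) ∧
      ∀ ξ, ‖𝓕 G ξ‖ = (2 * Real.pi * |ξ l|) ^ n * ‖𝓕 F ξ‖ := by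
  induction n with
  | zero => exact ⟨F, h, by simp⟩
  | succ n ih =>
    obtain ⟨G, h1, h2⟩ := ih
    refine ⟨∂_{EuclideanSpace.single l (1 : ℝ)} G, fun x => ?_, fun ξ => ?_⟩
    · rw [partialDeriv_eq_lineDerivOp h1, Function.iterate_succ_apply']
    · rw [norm_fourier_lineDerivOp, h2]; ring

lemma exists_schwartz_foldr (a : Fin d → ℕ) {g : 𝔼 → ℝ} {F : 𝓢(𝔼, ℂ)}
    (h : ∀ x, F x = g x) (L : List (Fin d)) : ∃ G : 𝓢(𝔼, ℂ),
      (∀ x, G x = (L.foldr (fun l h => (partialDeriv l)^[a l] h) g x : ℝ)) ∧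
      ∀ ξ, ‖𝓕 G ξ‖ = (L.map fun l => (2 * Real.pi * |ξ l|) ^ a l).prod * ‖𝓕 F ξ‖ := by
  induction L with
  | nil => exact ⟨F, h, by simp⟩
  | cons l L ih =>
    obtain ⟨G, h1, h2⟩ := ih
    obtain ⟨G', h3, h4⟩ := exists_schwartz_iterate l (a l) h1
    refine ⟨G', h3, fun ξ => ?_⟩
    rw [h4, h2, List.map_cons, List.prod_cons]; ring

/-- Fourier representation of a derivative of a test function: the derivatives turn into
monomials, and the Fourier transform of the function itself is bounded by its `L¹` norm. -/
lemma exists_fourier_repr_multiDeriv (a : Fin d → ℕ) {g : 𝔼 → ℝ} (hg : ContDiff ℝ ∞ g)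
    (hc : HasCompactSupport g) : ∃ h : 𝔼 → ℂ, Integrable h ∧
      (∀ ξ, ‖h ξ‖ₑ ≤ ENNReal.ofReal (∏ l, (2 * Real.pi * |ξ l|) ^ a l) * eLpNorm g 1 volume) ∧
      ∀ x, (multiDeriv a g x : ℂ) =
        ∫ ξ, h ξ * Complex.exp (((2 * Real.pi * inner ℝ ξ x : ℝ) : ℂ) * Complex.I) := by
  have hc' : HasCompactSupport fun x => (g x : ℂ) := hc.comp_left Complex.ofReal_zero
  have hg' : ContDiff ℝ ∞ fun x => (g x : ℂ) := Complex.ofRealCLM.contDiff.comp hg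
  obtain ⟨G, h1, h2⟩ := exists_schwartz_foldr a (F := hc'.toSchwartzMap hg') (g := g)
    (fun x => rfl) (List.finRange d)
  refine ⟨(𝓕 G : 𝓢(𝔼, ℂ)), (𝓕 G : 𝓢(𝔼, ℂ)).integrable, fun ξ => ?_, fun x => ?_⟩
  · rw [← ofReal_norm, h2, ← Fin.prod_univ_def, ENNReal.ofReal_mul (by positivity)]
    refine mul_le_mul_right ?_ _
    rw [ofReal_norm, SchwartzMap.fourier_coe, Real.fourier_eq]
    refine (enorm_integral_le_lintegral_enorm _).trans (le_of_eq ?_)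
    rw [eLpNorm_one_eq_lintegral_enorm]
    refine lintegral_congr fun v => ?_
    rw [← ofReal_norm, Circle.norm_smul, ← ofReal_norm]
    simp
  · rw [multiDeriv, ← h1]
    have e : 𝓕⁻ (𝓕 G) = G := FourierTransform.fourierInv_fourier_eq G
    conv_lhs => rw [← e]
    rw [SchwartzMap.fourierInv_coe, Real.fourierInv_eq']
    refine integral_congr_ae (Filter.Eventually.of_forall fun ξ => ?_)
    simp [mul_comm]

end fourier

/-! ### Expectations along fractional Brownian motion -/

section gaussian

variable {Ω : Type*} [MeasurableSpace Ω] {P : Measure Ω} {T H : ℝ} {d : ℕ}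
  {B : ℝ → Ω → EuclideanSpace ℝ (Fin d)}

lemma norm_sq_sum_smul {V : Type*} [NormedAddCommGroup V] [InnerProductSpace ℝ V] {m : ℕ}
    (c : Fin m → ℝ) (v : Fin m → V) :
    ‖∑ j, c j • v j‖ ^ 2 = ∑ i, ∑ j, c i * c j * inner ℝ (v i) (v j) := by
  rw [← real_inner_self_eq_norm_sq, sum_inner]
  refine Finset.sum_congr rfl fun i _ => ?_
  rw [inner_sum]
  refine Finset.sum_congr rfl fun j _ => ?_
  rw [real_inner_smul_left, real_inner_smul_right]; ring

lemma IsFractionalBrownianMotion.aemeasurable (hB : IsFractionalBrownianMotion P T H B) {t : ℝ}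
    (ht : t ∈ Icc 0 T) : AEMeasurable (B t) P :=
  hB.gaussian.aemeasurable ⟨t, ht⟩

lemma IsFractionalBrownianMotion.memLp (hB : IsFractionalBrownianMotion P T H B) {t : ℝ}
    (ht : t ∈ Icc 0 T) (l : Fin d) : MemLp (fun w => B t w l) 2 P :=
  ((hB.gaussian.hasGaussianLaw_eval ⟨t, ht⟩).map_fun
    (EuclideanSpace.proj l : EuclideanSpace ℝ (Fin d) →L[ℝ] ℝ)).memLp_two

/-- The characteristic function of the finite-dimensional distributions; the variance is written as
a squared norm through `fbmVec`, one summand for each of the independent components. -/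
lemma integral_cexp_fbm [IsProbabilityMeasure P] (hB : IsFractionalBrownianMotion P T H B)
    (hH0 : 0 < H) (hH : H < 1 / 2) {m : ℕ} {s : Fin m → ℝ} (hs : ∀ j, s j ∈ Icc 0 T)
    (ξ : Fin m → EuclideanSpace ℝ (Fin d)) :
    ∫ w, Complex.exp (((2 * Real.pi * ∑ j, inner ℝ (ξ j) (B (s j) w) : ℝ) : ℂ) * Complex.I) ∂P =
      (Real.exp (-(2 * Real.pi ^ 2) * ∑ l, ‖∑ j, ξ j l • fbmVec hH0 hH (s j)‖ ^ 2) : ℝ) := by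
  set Z : Ω → ℝ := fun w => ∑ j, inner ℝ (ξ j) (B (s j) w) with hZ
  have hG : HasGaussianLaw Z P := by
    have h1 := hB.gaussian.comp_right (fun j : Fin m => (⟨s j, hs j⟩ : Icc (0 : ℝ) T))
    have h2 := h1.comp_left (fun j => innerSL ℝ (ξ j))
    exact h2.hasGaussianLaw_fun_sum (I := Finset.univ)
  have hZe : ∀ w, Z w = ∑ p : Fin m × Fin d, ξ p.1 p.2 * B (s p.1) w p.2 := fun w => by
    rw [hZ, Fintype.sum_prod_type]
    refine Finset.sum_congr rfl fun j _ => ?_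
    rw [PiLp.inner_apply]
    exact Finset.sum_congr rfl fun l _ => by simp [mul_comm]
  have hL : ∀ p : Fin m × Fin d, MemLp (fun w => B (s p.1) w p.2) 2 P := fun p =>
    hB.memLp (hs p.1) p.2
  have hmean : ∫ w, Z w ∂P = 0 := by
    simp_rw [hZe]
    rw [integral_finsetSum _ fun p _ => ((hL p).integrable one_le_two).const_mul _]
    refine Finset.sum_eq_zero fun p _ => ?_
    rw [integral_const_mul, hB.centered _ (hs p.1), mul_zero]
  have hvar : variance Z P = ∑ l, ‖∑ j, ξ j l • fbmVec hH0 hH (s j)‖ ^ 2 := by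
    rw [variance_of_integral_eq_zero hG.aemeasurable hmean]
    have e1 : ∀ w, Z w ^ 2 = ∑ p : Fin m × Fin d, ∑ q : Fin m × Fin d,
        ξ p.1 p.2 * ξ q.1 q.2 * (B (s p.1) w p.2 * B (s q.1) w q.2) := fun w => by
      rw [hZe, sq, Finset.sum_mul_sum]
      exact Finset.sum_congr rfl fun p _ => Finset.sum_congr rfl fun q _ => by ring
    have hi : ∀ p q : Fin m × Fin d, Integrable (fun w =>
        ξ p.1 p.2 * ξ q.1 q.2 * (B (s p.1) w p.2 * B (s q.1) w q.2)) P := fun p q =>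
      ((hL p).integrable_mul (hL q)).const_mul _
    simp_rw [e1]
    rw [integral_finsetSum _ fun p _ => integrable_finsetSum _ fun q _ => hi p q]
    simp_rw [integral_finsetSum _ fun q _ => hi _ q, integral_const_mul]
    simp_rw [fun p q : Fin m × Fin d =>
      hB.covariance (s p.1) (hs p.1) (s q.1) (hs q.1) p.2 q.2]
    simp_rw [norm_sq_sum_smul, inner_fbmVec hH0 hH (hs _).1 (hs _).1]
    simp_rw [Fintype.sum_prod_type]
    rw [Finset.sum_comm]
    refine Finset.sum_congr rfl fun l _ => Finset.sum_congr rfl fun i _ =>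
      Finset.sum_congr rfl fun j _ => ?_
    simp
  have hmap := hG.map_eq_gaussianReal
  have hcf := charFun_apply_real (μ := P.map Z) (2 * Real.pi)
  rw [integral_map hG.aemeasurable (by fun_prop), hmap, charFun_gaussianReal, hmean, hvar] at hcf
  change ∫ w, Complex.exp (((2 * Real.pi * Z w : ℝ) : ℂ) * Complex.I) ∂P = _
  simp_rw [Complex.ofReal_mul (2 * Real.pi)]
  rw [← hcf, Complex.ofReal_exp]
  congr 1
  have e3 : (((∑ l, ‖∑ j, ξ j l • fbmVec hH0 hH (s j)‖ ^ 2).toNNReal : ℝ)) =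
      ∑ l, ‖∑ j, ξ j l • fbmVec hH0 hH (s j)‖ ^ 2 :=
    Real.coe_toNNReal _ (Finset.sum_nonneg fun _ _ => sq_nonneg _)
  rw [e3]
  push_cast; ring

/-- Fourier inversion in every factor turns the expectation into an integral against the
characteristic function of the Gaussian vector `(B_{s_1}, …, B_{s_m})`. -/
lemma enorm_integral_prod_multiDeriv_le [IsProbabilityMeasure P]
    (hB : IsFractionalBrownianMotion P T H B) (hH0 : 0 < H)
    (hH : H < 1 / 2) {m : ℕ} {s : Fin m → ℝ} (hs : ∀ j, s j ∈ Icc 0 T) (a : Fin m → Fin d → ℕ)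
    {g : Fin m → EuclideanSpace ℝ (Fin d) → ℝ} (hg : ∀ j, ContDiff ℝ ∞ (g j))
    (hc : ∀ j, HasCompactSupport (g j)) :
    ‖∫ w, ∏ j, multiDeriv (a j) (g j) (B (s j) w) ∂P‖ₑ ≤
      (∏ j, eLpNorm (g j) 1 volume) * ∫⁻ ξ : Fin m → EuclideanSpace ℝ (Fin d),
        ENNReal.ofReal ((∏ j, ∏ l, (2 * Real.pi * |ξ j l|) ^ a j l) *
          Real.exp (-(2 * Real.pi ^ 2) * ∑ l, ‖∑ j, ξ j l • fbmVec hH0 hH (s j)‖ ^ 2)) := by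
  choose h hi hb hr using fun j => exists_fourier_repr_multiDeriv (a j) (hg j) (hc j)
  set Ψ : Ω → (Fin m → EuclideanSpace ℝ (Fin d)) → ℂ := fun w ξ => ∏ j, (h j (ξ j) *
    Complex.exp (((2 * Real.pi * inner ℝ (ξ j) (B (s j) w) : ℝ) : ℂ) * Complex.I)) with hΨ
  have e1 : ∀ w, ((∏ j, multiDeriv (a j) (g j) (B (s j) w) : ℝ) : ℂ) = ∫ ξ, Ψ w ξ := fun w => by
    rw [Complex.ofReal_prod]
    simp_rw [hr]
    exact (integral_fintype_prod_volume_eq_prod (fun j (ξ : EuclideanSpace ℝ (Fin d)) => h j ξ *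
      Complex.exp (((2 * Real.pi * inner ℝ ξ (B (s j) w) : ℝ) : ℂ) * Complex.I))).symm
  have hexp : ∀ j (w : Ω) (ξ : EuclideanSpace ℝ (Fin d)),
      ‖Complex.exp (((2 * Real.pi * inner ℝ ξ (B (s j) w) : ℝ) : ℂ) * Complex.I)‖ = 1 :=
    fun j w ξ => Complex.norm_exp_ofReal_mul_I _
  have hΨi : Integrable (Function.uncurry Ψ) (P.prod volume) := by
    have h1 : Integrable (fun ξ : Fin m → EuclideanSpace ℝ (Fin d) => ∏ j, h j (ξ j)) :=
      Integrable.fintype_prod hi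
    have h2 : Integrable (fun z : Ω × (Fin m → EuclideanSpace ℝ (Fin d)) => ∏ j, h j (z.2 j))
      (P.prod volume) := h1.comp_snd P
    refine h2.mono ?_ (Filter.Eventually.of_forall fun z => ?_)
    · have h3 : ∀ j, AEMeasurable (fun z : Ω × (Fin m → EuclideanSpace ℝ (Fin d)) =>
          B (s j) z.1) (P.prod volume) := fun j =>
        (hB.aemeasurable (hs j)).comp_quasiMeasurePreserving Measure.quasiMeasurePreserving_fst
      have h4 : AEStronglyMeasurable (fun z : Ω × (Fin m → EuclideanSpace ℝ (Fin d)) =>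
          ∏ j, Complex.exp (((2 * Real.pi * inner ℝ (z.2 j) (B (s j) z.1) : ℝ) : ℂ) * Complex.I))
          (P.prod volume) := by
        refine AEMeasurable.aestronglyMeasurable (Finset.aemeasurable_fun_prod _ fun j _ => ?_)
        have h5 : AEMeasurable (fun z : Ω × (Fin m → EuclideanSpace ℝ (Fin d)) =>
            inner ℝ (z.2 j) (B (s j) z.1)) (P.prod volume) :=
          AEMeasurable.inner (by fun_prop) (h3 j)
        fun_prop
      refine (h2.aestronglyMeasurable.mul h4).congr (Filter.Eventually.of_forall fun z => ?_)
      simp only [Pi.mul_apply, Function.uncurry, hΨ, Finset.prod_mul_distrib]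
    · simp only [Function.uncurry, hΨ, norm_prod, norm_mul, hexp, mul_one, le_refl]
  -- Fubini; the inner integral over `Ω` is the characteristic function.
  have e2 : ((∫ w, ∏ j, multiDeriv (a j) (g j) (B (s j) w) ∂P : ℝ) : ℂ) =
      ∫ ξ : Fin m → EuclideanSpace ℝ (Fin d), (∏ j, h j (ξ j)) *
        (Real.exp (-(2 * Real.pi ^ 2) * ∑ l, ‖∑ j, ξ j l • fbmVec hH0 hH (s j)‖ ^ 2) : ℝ) := by
    rw [← integral_complex_ofReal]
    simp_rw [e1]
    rw [integral_integral_swap hΨi]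
    refine integral_congr_ae (Filter.Eventually.of_forall fun ξ => ?_)
    simp only [hΨ, Finset.prod_mul_distrib]
    rw [integral_const_mul, ← integral_cexp_fbm hB hH0 hH hs ξ]
    congr 1
    refine integral_congr_ae (Filter.Eventually.of_forall fun w => ?_)
    simp only [← Complex.exp_sum, ← Finset.sum_mul, ← Complex.ofReal_sum, ← Finset.mul_sum]
  have e3 : ‖∫ w, ∏ j, multiDeriv (a j) (g j) (B (s j) w) ∂P‖ₑ =
      ‖((∫ w, ∏ j, multiDeriv (a j) (g j) (B (s j) w) ∂P : ℝ) : ℂ)‖ₑ := by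
    rw [← ofReal_norm, ← ofReal_norm, Complex.norm_real]
  rw [e3, e2]
  refine (enorm_integral_le_lintegral_enorm _).trans ?_
  by_cases htop : ∏ j, eLpNorm (g j) 1 volume = ⊤
  · exfalso
    refine ENNReal.prod_ne_top (fun j _ => ?_) htop
    exact (((hg j).continuous.memLp_of_hasCompactSupport (hc j)).eLpNorm_lt_top).ne
  rw [← lintegral_const_mul' _ _ htop]
  refine lintegral_mono fun ξ => ?_
  rw [enorm_mul, ENNReal.ofReal_mul (by positivity), ← mul_assoc]
  refine mul_le_mul' ?_ ?_
  · rw [← ofReal_norm, norm_prod, ENNReal.ofReal_prod_of_nonneg (fun j _ => norm_nonneg _),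
      ENNReal.ofReal_prod_of_nonneg (fun j _ => by positivity), ← Finset.prod_mul_distrib]
    simp_rw [ofReal_norm]
    exact Finset.prod_le_prod' fun j _ => (hb j (ξ j)).trans_eq (mul_comm _ _)
  · rw [← ofReal_norm, Complex.norm_real, Real.norm_of_nonneg (Real.exp_pos _).le]

end gaussian

/-! ### Increments of the Volterra kernel -/

/-- With `z = h / y`, `(1 + z) ^ (-b) ≥ (1 + z) ^ (-2) ≥ 1 - 2 z`. -/
lemma rpow_neg_sub_rpow_neg_le {y h b : ℝ} (hy : 0 < y) (hh : 0 ≤ h) (hb2 : b ≤ 2) :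
    y ^ (-b) - (y + h) ^ (-b) ≤ 2 * y ^ (-b - 1) * h := by
  have hyh : 0 < y + h := by linarith
  have hq0 : 0 < y / (y + h) := by positivity
  have hq1 : y / (y + h) ≤ 1 := (div_le_one hyh).2 (by linarith)
  have e1 : (y + h) ^ (-b) = y ^ (-b) * (y / (y + h)) ^ b := by
    rw [Real.div_rpow hy.le hyh.le, Real.rpow_neg hy.le, Real.rpow_neg hyh.le]
    have := (Real.rpow_pos_of_pos hy b).ne'
    field_simp
  have h1 : (y / (y + h)) ^ (2 : ℝ) ≤ (y / (y + h)) ^ b :=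
    Real.rpow_le_rpow_of_exponent_ge hq0 hq1 hb2
  have h2 : 1 - 2 * (h / y) ≤ (y / (y + h)) ^ (2 : ℝ) := by
    rw [Real.rpow_two]
    have e2 : y / (y + h) = 1 - h / (y + h) := by field_simp; ring
    have h3 : h / (y + h) ≤ h / y := div_le_div_of_nonneg_left hh hy (by linarith)
    rw [e2]; nlinarith [sq_nonneg (h / (y + h))]
  have hp : 0 < y ^ (-b) := Real.rpow_pos_of_pos hy _
  calc y ^ (-b) - (y + h) ^ (-b) = y ^ (-b) * (1 - (y / (y + h)) ^ b) := by rw [e1]; ring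
    _ ≤ y ^ (-b) * (2 * (h / y)) := by gcongr; linarith
    _ = 2 * y ^ (-b - 1) * h := by rw [Real.rpow_sub_one hy.ne']; ring

lemma rpow_sub_rpow_le {x y a : ℝ} (hx : 0 < x) (hxy : x ≤ y) (ha1 : a ≤ 1) :
    y ^ a - x ^ a ≤ x ^ (a - 1) * (y - x) := by
  have h1 : (y / x) ^ a ≤ (y / x) ^ (1 : ℝ) :=
    Real.rpow_le_rpow_of_exponent_le ((one_le_div hx).2 hxy) ha1
  rw [Real.rpow_one, Real.div_rpow (hx.le.trans hxy) hx.le,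
    div_le_iff₀ (Real.rpow_pos_of_pos hx _)] at h1
  rw [Real.rpow_sub_one hx.ne']
  have : y / x * x ^ a = x ^ a / x * (y - x) + x ^ a := by field_simp; ring
  linarith

lemma intervalIntegrable_volterra {H θ b : ℝ} (hH0 : 0 < H) (hθ : 0 < θ) (hb : θ ≤ b) :
    IntervalIntegrable (fun u => u ^ (H - 3 / 2) * (u - θ) ^ (H - 1 / 2)) volume θ b := by
  refine IntervalIntegrable.continuousOn_mul ?_ ?_
  · have := (intervalIntegral.intervalIntegrable_rpow' (a := 0) (b := b - θ)
      (show -1 < H - 1 / 2 by linarith)).comp_sub_right θ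
    simpa using this
  · rw [uIcc_of_le hb]
    exact continuousOn_id.rpow_const fun u hu => Or.inl (hθ.trans_le hu.1).ne'

lemma continuousOn_volterraKernel {H θ b : ℝ} (hH0 : 0 < H) (hθ : 0 < θ) (hb : θ ≤ b) :
    ContinuousOn (fun s => volterraKernel H s θ) (Ioc θ b) := by
  unfold volterraKernel
  have h1 : ContinuousOn (fun s => ∫ u in θ..s, u ^ (H - 3 / 2) * (u - θ) ^ (H - 1 / 2))
      (Ioc θ b) := by
    have := intervalIntegral.continuousOn_primitive_interval
      ((intervalIntegrable_iff' enorm_ne_top).1 (intervalIntegrable_volterra hH0 hθ hb))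
    rw [uIcc_of_le hb] at this
    exact this.mono Ioc_subset_Icc_self
  refine continuousOn_const.mul (ContinuousOn.sub (ContinuousOn.mul ?_ ?_)
    (continuousOn_const.mul h1))
  · exact ContinuousOn.rpow_const (by fun_prop) fun s hs =>
      Or.inl (div_pos (hθ.trans hs.1) hθ).ne'
  · exact ContinuousOn.rpow_const (by fun_prop) fun s hs => Or.inl (sub_pos.2 hs.1).ne'

/-- The integral in the Volterra kernel, shifted to start at `0`. -/
lemma integral_volterra_eq (H θ s : ℝ) :
    ∫ u in θ..s, u ^ (H - 3 / 2) * (u - θ) ^ (H - 1 / 2) =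
      ∫ v in (0 : ℝ)..(s - θ), (θ + v) ^ (H - 3 / 2) * v ^ (H - 1 / 2) := by
  have := intervalIntegral.integral_comp_sub_right (a := θ) (b := s)
    (fun v => (θ + v) ^ (H - 3 / 2) * v ^ (H - 1 / 2)) θ
  simpa using this

lemma intervalIntegrable_volterra_shift {H θ x y : ℝ} (hH0 : 0 < H) (hθ : 0 < θ) (hx : 0 ≤ x)
    (hy : 0 ≤ y) :
    IntervalIntegrable (fun v => (θ + v) ^ (H - 3 / 2) * v ^ (H - 1 / 2)) volume x y := by
  refine IntervalIntegrable.continuousOn_mul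
    (intervalIntegral.intervalIntegrable_rpow' (by linarith)) ?_
  refine ContinuousOn.rpow_const (by fun_prop) fun v hv => Or.inl ?_
  have : 0 ≤ v := (le_min hx hy).trans hv.1
  linarith

section estimates

variable {H θ₀ θ' θ s T : ℝ}

lemma integral_rpow_le (hH0 : 0 < H) {x : ℝ} (hx : 0 ≤ x) (hxT : x ≤ T) :
    ∫ v in (0 : ℝ)..x, v ^ (H - 1 / 2) ≤ T ^ (H + 1 / 2) / (H + 1 / 2) := by
  rw [integral_rpow (Or.inl (by linarith)), Real.zero_rpow (by linarith), sub_zero,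
    show H - 1 / 2 + 1 = H + 1 / 2 by ring]
  gcongr

lemma integral_volterra_nonneg (hθ : 0 < θ) {x : ℝ} (hx : 0 ≤ x) :
    0 ≤ ∫ v in (0 : ℝ)..x, (θ + v) ^ (H - 3 / 2) * v ^ (H - 1 / 2) :=
  intervalIntegral.integral_nonneg hx fun v hv => by
    have := hv.1
    positivity

lemma integral_volterra_le (hH0 : 0 < H) (hH : H < 1 / 2) (hθ₀ : 0 < θ₀) (hθ : θ₀ ≤ θ) {x : ℝ}
    (hx : 0 ≤ x) (hxT : x ≤ T) :
    ∫ v in (0 : ℝ)..x, (θ + v) ^ (H - 3 / 2) * v ^ (H - 1 / 2) ≤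
      θ₀ ^ (H - 3 / 2) * (T ^ (H + 1 / 2) / (H + 1 / 2)) := by
  calc _ ≤ ∫ v in (0 : ℝ)..x, θ₀ ^ (H - 3 / 2) * v ^ (H - 1 / 2) := by
        refine intervalIntegral.integral_mono_on hx
          (intervalIntegrable_volterra_shift hH0 (hθ₀.trans_le hθ) le_rfl hx)
          ((intervalIntegral.intervalIntegrable_rpow' (by linarith)).const_mul _) fun v hv => ?_
        exact mul_le_mul_of_nonneg_right
          (Real.rpow_le_rpow_of_nonpos hθ₀ (by linarith [hv.1]) (by linarith))
          (Real.rpow_nonneg hv.1 _)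
    _ ≤ _ := by
        rw [intervalIntegral.integral_const_mul]
        exact mul_le_mul_of_nonneg_left (integral_rpow_le hH0 hx hxT) (by positivity)

/-- Comparison on the common range `[0, s - θ]`, plus the remaining range of length `θ - θ'`. -/
lemma abs_integral_volterra_sub_le (hH0 : 0 < H) (hH : H < 1 / 2) (hθ₀ : 0 < θ₀) (hθ : θ₀ ≤ θ')
    (hθθ : θ' < θ) (hs : θ < s) (hT : s ≤ T) :
    |(∫ v in (0 : ℝ)..(s - θ), (θ + v) ^ (H - 3 / 2) * v ^ (H - 1 / 2)) -
      ∫ v in (0 : ℝ)..(s - θ'), (θ' + v) ^ (H - 3 / 2) * v ^ (H - 1 / 2)| ≤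
      2 * θ₀ ^ (H - 5 / 2) * (T ^ (H + 1 / 2) / (H + 1 / 2)) * (θ - θ') +
      θ₀ ^ (H - 3 / 2) * (s - θ) ^ (H - 1 / 2) * (θ - θ') := by
  have hx : 0 < s - θ := by linarith
  have hx' : 0 < s - θ' := by linarith
  have h0' : 0 < θ' := hθ₀.trans_le hθ
  have h0 : 0 < θ := by linarith
  rw [← intervalIntegral.integral_add_adjacent_intervals (b := s - θ)
    (intervalIntegrable_volterra_shift hH0 h0' le_rfl hx.le)
    (intervalIntegrable_volterra_shift hH0 h0' hx.le hx'.le), ← sub_sub,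
    ← intervalIntegral.integral_sub (intervalIntegrable_volterra_shift hH0 h0 le_rfl hx.le)
      (intervalIntegrable_volterra_shift hH0 h0' le_rfl hx.le)]
  refine (abs_sub _ _).trans (add_le_add ?_ ?_)
  · have hle : ∀ v ∈ Ioc 0 (s - θ), ‖(θ + v) ^ (H - 3 / 2) * v ^ (H - 1 / 2) -
        (θ' + v) ^ (H - 3 / 2) * v ^ (H - 1 / 2)‖ ≤
        2 * θ₀ ^ (H - 5 / 2) * (θ - θ') * v ^ (H - 1 / 2) := by
      intro v hv
      have hv0 : 0 < v := hv.1
      have hvp : 0 ≤ v ^ (H - 1 / 2) := by positivity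
      have h1 := rpow_neg_sub_rpow_neg_le (y := θ' + v) (h := θ - θ') (b := 3 / 2 - H)
        (by linarith) (by linarith) (by linarith)
      rw [show -(3 / 2 - H) = H - 3 / 2 by ring, show θ' + v + (θ - θ') = θ + v by ring,
        show H - 3 / 2 - 1 = H - 5 / 2 by ring] at h1
      have h2 : (θ' + v) ^ (H - 5 / 2) ≤ θ₀ ^ (H - 5 / 2) :=
        Real.rpow_le_rpow_of_nonpos hθ₀ (by linarith) (by linarith)
      have h3 : (θ + v) ^ (H - 3 / 2) ≤ (θ' + v) ^ (H - 3 / 2) :=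
        Real.rpow_le_rpow_of_nonpos (by linarith) (by linarith) (by linarith)
      rw [← sub_mul, norm_mul, Real.norm_eq_abs, Real.norm_eq_abs, abs_sub_comm,
        abs_of_nonneg (by linarith), abs_of_nonneg hvp]
      refine mul_le_mul_of_nonneg_right (h1.trans ?_) hvp
      have : 0 ≤ θ - θ' := by linarith
      gcongr
    have h4 := intervalIntegral.norm_integral_le_of_norm_le hx.le
      (Filter.Eventually.of_forall fun v hv => hle v hv)
      ((intervalIntegral.intervalIntegrable_rpow' (by linarith)).const_mul _)
    refine h4.trans ?_
    rw [intervalIntegral.integral_const_mul]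
    calc _ ≤ 2 * θ₀ ^ (H - 5 / 2) * (θ - θ') * (T ^ (H + 1 / 2) / (H + 1 / 2)) := by
          refine mul_le_mul_of_nonneg_left (integral_rpow_le hH0 hx.le (by linarith)) ?_
          have : 0 ≤ θ - θ' := by linarith
          positivity
      _ = _ := by ring
  · have h5 := intervalIntegral.norm_integral_le_of_norm_le_const (a := s - θ) (b := s - θ')
      (f := fun v => (θ' + v) ^ (H - 3 / 2) * v ^ (H - 1 / 2))
      (C := θ₀ ^ (H - 3 / 2) * (s - θ) ^ (H - 1 / 2)) (by
        intro v hv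
        rw [uIoc_of_le (by linarith)] at hv
        have hv0 : s - θ < v := hv.1
        rw [norm_mul, Real.norm_of_nonneg (Real.rpow_nonneg (by linarith) _),
          Real.norm_of_nonneg (Real.rpow_nonneg (by linarith) _)]
        refine mul_le_mul (Real.rpow_le_rpow_of_nonpos hθ₀ (by linarith) (by linarith))
          (Real.rpow_le_rpow_of_nonpos hx hv0.le (by linarith))
          (Real.rpow_nonneg (by linarith) _) (by positivity))
    rw [show s - θ' - (s - θ) = θ - θ' by ring, abs_of_pos (by linarith)] at h5
    exact h5

set_option maxHeartbeats 2000000 in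
/-- The increment of the Volterra kernel in its second variable, uniformly in the Hölder
exponent `γ`: every contribution is at most a constant times `x ^ (H - 1/2) * min 1 (h / x)` with
`x = s - θ` and `h = θ - θ'`. -/
lemma exists_abs_volterraKernel_sub_le (hH0 : 0 < H) (hH : H < 1 / 2) (hθ₀ : 0 < θ₀) (T : ℝ) :
    ∃ C : ℝ, 0 < C ∧ ∀ θ' θ s γ : ℝ, θ₀ ≤ θ' → θ' < θ → θ < s → s ≤ T → 0 < γ → γ < H →
      |volterraKernel H s θ - volterraKernel H s θ'| ≤
        C * ((θ - θ') ^ γ * (s - θ) ^ (H - 1 / 2 - γ)) := by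
  rcases le_or_gt T 0 with hT0 | hT0
  · exact ⟨1, one_pos, fun θ' θ s γ h1 h2 h3 h4 => by linarith⟩
  set c := Real.sqrt (2 * H / ((1 - 2 * H) * ProbabilityTheory.beta (1 - 2 * H) (H + 1 / 2)))
    with hc
  set a := 1 / 2 - H with ha
  have ha0 : 0 < a := by linarith
  set L := θ₀ ^ (a - 1) with hL
  set R := T ^ (H + 1 / 2) / (H + 1 / 2) with hR
  set C := c * (θ₀ ^ (-a) * (T ^ a * 2 + L * T) +
    a * (T ^ a * (2 * θ₀ ^ (H - 5 / 2) * R * T ^ (1 + a) + θ₀ ^ (H - 3 / 2) * T) +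
      L * T ^ (1 + a) * (θ₀ ^ (H - 3 / 2) * R))) with hC
  have hR0 : 0 < R := by positivity
  have hL0 : 0 < L := by positivity
  have hc0 : 0 ≤ c := Real.sqrt_nonneg _
  refine ⟨C + 1, by positivity, ?_⟩
  intro θ' θ s γ h1 h2 h3 h4 hγ0 hγ
  have hθ'0 : 0 < θ' := hθ₀.trans_le h1
  have hθ0 : 0 < θ := hθ'0.trans h2
  have hs0 : 0 < s := hθ0.trans h3
  set x := s - θ with hx
  set h := θ - θ' with hh
  have hx0 : 0 < x := sub_pos.2 h3
  have hh0 : 0 < h := sub_pos.2 h2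
  have hxT : x ≤ T := by linarith
  have hhT : h ≤ T := by linarith
  -- `M` dominates every contribution; only the last comparison involves `γ`.
  set M := x ^ (-a) * min 1 (h / x) with hM
  have hxa : 0 < x ^ (-a) := by positivity
  have hM1 : h * x ^ (-a) ≤ T * M := by
    have : h ≤ T * min 1 (h / x) := by
      rcases le_total 1 (h / x) with hc | hc
      · rw [min_eq_left hc]; linarith
      · rw [min_eq_right hc, mul_div_assoc', le_div_iff₀ hx0, mul_comm]; gcongr
    calc h * x ^ (-a) ≤ T * min 1 (h / x) * x ^ (-a) := by gcongr
      _ = T * M := by rw [hM]; ring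
  have hM2 : h ≤ T ^ (1 + a) * M := by
    have : 1 ≤ T ^ a * x ^ (-a) := by
      rw [Real.rpow_neg hx0.le, ← div_eq_mul_inv, one_le_div (by positivity)]
      exact Real.rpow_le_rpow hx0.le hxT ha0.le
    calc h ≤ h * (T ^ a * x ^ (-a)) := le_mul_of_one_le_right hh0.le this
      _ = T ^ a * (h * x ^ (-a)) := by ring
      _ ≤ T ^ a * (T * M) := by gcongr
      _ = T ^ (1 + a) * M := by rw [Real.rpow_add hT0, Real.rpow_one]; ring
  have hM0 : 0 < M := mul_pos hxa (lt_min one_pos (by positivity))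
  have hM3 : M ≤ h ^ γ * x ^ (H - 1 / 2 - γ) := by
    have e : h ^ γ * x ^ (H - 1 / 2 - γ) = x ^ (-a) * (h / x) ^ γ := by
      rw [show H - 1 / 2 - γ = -a - γ by rw [ha]; ring, Real.rpow_sub hx0,
        Real.div_rpow hh0.le hx0.le]
      ring
    rw [e, hM]
    refine mul_le_mul_of_nonneg_left ?_ hxa.le
    rcases le_total 1 (h / x) with hc | hc
    · rw [min_eq_left hc]; exact Real.one_le_rpow hc hγ0.le
    · rw [min_eq_right hc]
      calc h / x = (h / x) ^ (1 : ℝ) := (Real.rpow_one _).symm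
        _ ≤ _ := Real.rpow_le_rpow_of_exponent_ge (by positivity) hc (by linarith)
  have hd1 : 0 ≤ x ^ (-a) - (x + h) ^ (-a) ∧ x ^ (-a) - (x + h) ^ (-a) ≤ 2 * M := by
    refine ⟨sub_nonneg.2 (Real.rpow_le_rpow_of_nonpos hx0 (by linarith) (by linarith)), ?_⟩
    have e1 := rpow_neg_sub_rpow_neg_le hx0 hh0.le (by linarith : a ≤ 2)
    have e2 : 0 ≤ (x + h) ^ (-a) := by positivity
    rw [Real.rpow_sub_one hx0.ne'] at e1
    rw [hM]
    rcases le_total 1 (h / x) with hc | hc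
    · rw [min_eq_left hc]; linarith
    · rw [min_eq_right hc]
      refine e1.trans (le_of_eq ?_); ring
  have hd2 : 0 ≤ θ ^ a - θ' ^ a ∧ θ ^ a - θ' ^ a ≤ L * h := by
    refine ⟨sub_nonneg.2 (Real.rpow_le_rpow hθ'0.le h2.le ha0.le), ?_⟩
    refine (rpow_sub_rpow_le hθ'0 h2.le (by linarith)).trans ?_
    exact mul_le_mul_of_nonneg_right (Real.rpow_le_rpow_of_nonpos hθ₀ h1 (by linarith)) hh0.le
  set J := ∫ v in (0 : ℝ)..x, (θ + v) ^ (H - 3 / 2) * v ^ (H - 1 / 2) with hJ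
  set J' := ∫ v in (0 : ℝ)..(s - θ'), (θ' + v) ^ (H - 3 / 2) * v ^ (H - 1 / 2) with hJ'
  have hJ1 : |J - J'| ≤ (2 * θ₀ ^ (H - 5 / 2) * R * T ^ (1 + a) + θ₀ ^ (H - 3 / 2) * T) * M := by
    refine (abs_integral_volterra_sub_le hH0 hH hθ₀ h1 h2 h3 h4).trans ?_
    have e1 : 2 * θ₀ ^ (H - 5 / 2) * R * h ≤ 2 * θ₀ ^ (H - 5 / 2) * R * (T ^ (1 + a) * M) := by
      gcongr
    have e2 : θ₀ ^ (H - 3 / 2) * (h * x ^ (-a)) ≤ θ₀ ^ (H - 3 / 2) * (T * M) := by gcongr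
    have e3 : x ^ (H - 1 / 2) = x ^ (-a) := by congr 1; rw [ha]; ring
    rw [e3]
    linarith
  have hJ2 : |J'| ≤ θ₀ ^ (H - 3 / 2) * R := by
    rw [abs_of_nonneg (integral_volterra_nonneg hθ'0 (by linarith))]
    exact integral_volterra_le hH0 hH hθ₀ h1 (by linarith) (by linarith)
  -- `s ^ (H - 1/2)` and `τ ^ (1/2 - H)` are separated, and the minus sign is absorbed into `a`.
  have hK : ∀ τ, 0 < τ → volterraKernel H s τ = c * (s ^ (-a) * (τ ^ a * (s - τ) ^ (-a)) +
      a * (τ ^ a * ∫ v in (0 : ℝ)..(s - τ), (τ + v) ^ (H - 3 / 2) * v ^ (H - 1 / 2))) := by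
    intro τ hτ
    rw [volterraKernel, integral_volterra_eq, show H - 1 / 2 = -a by rw [ha]; ring, ← ha, ← hc,
      Real.div_rpow hs0.le hτ.le, Real.rpow_neg hτ.le, div_inv_eq_mul]
    ring
  rw [hK θ hθ0, hK θ' hθ'0]
  have hxh : s - θ' = x + h := by rw [hx, hh]; ring
  have e0 : c * (s ^ (-a) * (θ ^ a * (s - θ) ^ (-a)) + a * (θ ^ a * J)) -
      c * (s ^ (-a) * (θ' ^ a * (s - θ') ^ (-a)) + a * (θ' ^ a * J')) =
      c * (s ^ (-a) * (θ ^ a * (x ^ (-a) - (x + h) ^ (-a)) + (θ ^ a - θ' ^ a) * (x + h) ^ (-a)) +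
        a * (θ ^ a * (J - J') + (θ ^ a - θ' ^ a) * J')) := by
    rw [hxh, ← hx]; ring
  rw [e0]
  have hsa : s ^ (-a) ≤ θ₀ ^ (-a) := Real.rpow_le_rpow_of_nonpos hθ₀ (by linarith) (by linarith)
  have hθa : θ ^ a ≤ T ^ a := Real.rpow_le_rpow hθ0.le (by linarith) ha0.le
  have hxha : (x + h) ^ (-a) ≤ x ^ (-a) :=
    Real.rpow_le_rpow_of_nonpos hx0 (by linarith) (by linarith)
  have f1 : |s ^ (-a) * (θ ^ a * (x ^ (-a) - (x + h) ^ (-a)) +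
      (θ ^ a - θ' ^ a) * (x + h) ^ (-a))| ≤ θ₀ ^ (-a) * (T ^ a * 2 + L * T) * M := by
    have g1 := hd1.1
    have g2 := hd2.1
    rw [abs_of_nonneg (by positivity)]
    calc _ ≤ θ₀ ^ (-a) * (T ^ a * (2 * M) + (L * h) * x ^ (-a)) := by
          gcongr
          exacts [hd1.2, hd2.2]
      _ = θ₀ ^ (-a) * (T ^ a * (2 * M) + L * (h * x ^ (-a))) := by ring
      _ ≤ θ₀ ^ (-a) * (T ^ a * (2 * M) + L * (T * M)) := by gcongr
      _ = _ := by ring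
  have f2 : |θ ^ a * (J - J') + (θ ^ a - θ' ^ a) * J'| ≤
      (T ^ a * (2 * θ₀ ^ (H - 5 / 2) * R * T ^ (1 + a) + θ₀ ^ (H - 3 / 2) * T) +
      L * T ^ (1 + a) * (θ₀ ^ (H - 3 / 2) * R)) * M := by
    refine (abs_add_le _ _).trans ?_
    rw [abs_mul, abs_mul, abs_of_nonneg (by positivity : 0 ≤ θ ^ a), abs_of_nonneg hd2.1]
    calc _ ≤ T ^ a * ((2 * θ₀ ^ (H - 5 / 2) * R * T ^ (1 + a) + θ₀ ^ (H - 3 / 2) * T) * M) +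
          (L * (T ^ (1 + a) * M)) * (θ₀ ^ (H - 3 / 2) * R) := by
          gcongr
          exact hd2.2.trans (by gcongr)
      _ = _ := by ring
  rw [abs_mul, abs_of_nonneg hc0]
  calc _ ≤ c * (θ₀ ^ (-a) * (T ^ a * 2 + L * T) * M + a * ((T ^ a * (2 * θ₀ ^ (H - 5 / 2) * R *
        T ^ (1 + a) + θ₀ ^ (H - 3 / 2) * T) + L * T ^ (1 + a) * (θ₀ ^ (H - 3 / 2) * R)) * M)) := by
        refine mul_le_mul_of_nonneg_left ?_ hc0
        refine (abs_add_le _ _).trans (add_le_add f1 ?_)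
        rw [abs_mul, abs_of_pos ha0]
        exact mul_le_mul_of_nonneg_left f2 ha0.le
    _ = C * M := by rw [hC]; ring
    _ ≤ (C + 1) * M := by rw [add_mul, one_mul]; exact le_add_of_nonneg_right hM0.le
    _ ≤ (C + 1) * (h ^ γ * x ^ (H - 1 / 2 - γ)) := by
        refine mul_le_mul_of_nonneg_left hM3 (by positivity)

end estimates

/-! ### Beta integrals over the simplex -/

lemma Gamma_le_two_mul_Gamma_add {y ρ : ℝ} (hy : 1 / 2 ≤ y) (hρ : 0 ≤ ρ) (hρ1 : ρ ≤ 1 / 2) :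
    Real.Gamma y ≤ 2 * Real.Gamma (y + ρ) := by
  have hy0 : 0 < y := by linarith
  have hz : 0 < y + ρ := by linarith
  rcases hρ.eq_or_lt with h0 | h0
  · rw [← h0, add_zero]; linarith [Real.Gamma_pos_of_pos hy0]
  -- `y + 1` lies between `y + ρ` and `y + ρ + 1`; apply log-convexity.
  have h1 := Real.Gamma_mul_add_mul_le_rpow_Gamma_mul_rpow_Gamma hz
    (by linarith : 0 < y + ρ + 1) h0 (by linarith : 0 < 1 - ρ) (by ring)
  rw [show ρ * (y + ρ) + (1 - ρ) * (y + ρ + 1) = y + 1 by ring, Real.Gamma_add_one hy0.ne',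
    Real.Gamma_add_one hz.ne', Real.mul_rpow hz.le (Real.Gamma_pos_of_pos hz).le] at h1
  have h2 : Real.Gamma (y + ρ) ^ ρ * ((y + ρ) ^ (1 - ρ) * Real.Gamma (y + ρ) ^ (1 - ρ)) =
      (y + ρ) ^ (1 - ρ) * Real.Gamma (y + ρ) := by
    have h3 : Real.Gamma (y + ρ) ^ ρ * Real.Gamma (y + ρ) ^ (1 - ρ) = Real.Gamma (y + ρ) := by
      rw [← Real.rpow_add (Real.Gamma_pos_of_pos hz), add_sub_cancel, Real.rpow_one]
    calc _ = (y + ρ) ^ (1 - ρ) * (Real.Gamma (y + ρ) ^ ρ * Real.Gamma (y + ρ) ^ (1 - ρ)) := by ring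
      _ = _ := by rw [h3]
  rw [h2] at h1
  have h4 : (y + ρ) ^ (1 - ρ) ≤ 2 * y := by
    rcases le_total 1 (y + ρ) with h | h
    · calc (y + ρ) ^ (1 - ρ) ≤ (y + ρ) ^ (1 : ℝ) :=
            Real.rpow_le_rpow_of_exponent_le h (by linarith)
        _ ≤ 2 * y := by rw [Real.rpow_one]; linarith
    · exact (Real.rpow_le_one hz.le h (by linarith)).trans (by linarith)
  have h5 : y * Real.Gamma y ≤ y * (2 * Real.Gamma (y + ρ)) := by
    refine h1.trans ?_
    calc _ ≤ 2 * y * Real.Gamma (y + ρ) :=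
          mul_le_mul_of_nonneg_right h4 (Real.Gamma_pos_of_pos hz).le
      _ = _ := by ring
  exact le_of_mul_le_mul_left h5 hy0

/-- From Legendre's duplication formula at `Q + 1/2`. -/
lemma sqrt_Gamma_le {Q : ℝ} {m : ℕ} (hQ : 0 ≤ Q) (hQm : Q ≤ m) :
    Real.sqrt (Real.Gamma (2 * Q + 1)) ≤ 2 * 2 ^ m * Real.Gamma (Q + 1) := by
  have h1 := Real.Gamma_mul_Gamma_add_half (Q + 1 / 2)
  rw [show Q + 1 / 2 + 1 / 2 = Q + 1 by ring, show 2 * (Q + 1 / 2) = 2 * Q + 1 by ring,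
    show 1 - (2 * Q + 1) = -(2 * Q) by ring] at h1
  have h2 := Gamma_le_two_mul_Gamma_add (y := Q + 1 / 2) (ρ := 1 / 2) (by linarith) (by norm_num)
    le_rfl
  rw [show Q + 1 / 2 + 1 / 2 = Q + 1 by ring] at h2
  have hG : 0 < Real.Gamma (Q + 1) := Real.Gamma_pos_of_pos (by linarith)
  have hG2 : 0 < Real.Gamma (2 * Q + 1) := Real.Gamma_pos_of_pos (by linarith)
  have hpi : 1 ≤ Real.sqrt Real.pi := by
    rw [← Real.sqrt_one]; exact Real.sqrt_le_sqrt (by linarith [Real.pi_gt_three])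
  have h4 : (2 : ℝ) ^ (2 * Q) ≤ 4 ^ m := by
    rw [Real.rpow_mul (by norm_num), Real.rpow_two, show (2 : ℝ) ^ 2 = 4 by norm_num,
      ← Real.rpow_natCast]
    exact Real.rpow_le_rpow_of_exponent_le (by norm_num) hQm
  have hp : (0 : ℝ) < 2 ^ (2 * Q) := by positivity
  have h5 : Real.Gamma (2 * Q + 1) ≤
      2 ^ (2 * Q) * (Real.Gamma (Q + 1 / 2) * Real.Gamma (Q + 1)) := by
    rw [h1, Real.rpow_neg (by norm_num)]
    calc Real.Gamma (2 * Q + 1) ≤ Real.Gamma (2 * Q + 1) * Real.sqrt Real.pi :=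
          le_mul_of_one_le_right hG2.le hpi
      _ = _ := by field_simp
  refine Real.sqrt_le_iff.2 ⟨by positivity, h5.trans ?_⟩
  calc (2 : ℝ) ^ (2 * Q) * (Real.Gamma (Q + 1 / 2) * Real.Gamma (Q + 1))
      ≤ 4 ^ m * (2 * Real.Gamma (Q + 1) * Real.Gamma (Q + 1)) := by gcongr
    _ ≤ 4 ^ m * (4 * Real.Gamma (Q + 1) * Real.Gamma (Q + 1)) := by gcongr; norm_num
    _ = _ := by
        rw [mul_pow, mul_pow, ← pow_mul, mul_comm m 2, pow_mul]; ring

/-- The Beta integral on `(θ, y)`, by rescaling the density of the Beta distribution. -/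
lemma lintegral_beta {p q : ℝ} (hp : 0 < p) (hq : 0 < q) {θ y : ℝ} (hy : θ < y) :
    ∫⁻ s in Ioo θ y, ENNReal.ofReal ((y - s) ^ (p - 1) * (s - θ) ^ (q - 1)) =
      ENNReal.ofReal
        ((y - θ) ^ (p + q - 1) * (Real.Gamma p * Real.Gamma q / Real.Gamma (p + q))) := by
  have hL : 0 < y - θ := sub_pos.2 hy
  have hβ : 0 < ProbabilityTheory.beta q p := beta_pos hq hp
  have hscale : ∫⁻ s, betaPDF q p ((y - θ)⁻¹ * (s - θ)) = ENNReal.ofReal (y - θ) := by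
    rw [lintegral_sub_right_eq_self (fun s => betaPDF q p ((y - θ)⁻¹ * s)) θ]
    have hm : Measurable (betaPDF q p) := (measurable_betaPDFReal q p).ennreal_ofReal
    rw [← lintegral_map hm (measurable_const_mul _), Real.map_volume_mul_left (inv_ne_zero hL.ne'),
      lintegral_smul_measure, lintegral_betaPDF_eq_one hq hp, inv_inv, abs_of_pos hL]
    simp
  have hpt : ∀ s, (Ioo θ y).indicator
      (fun s => ENNReal.ofReal ((y - s) ^ (p - 1) * (s - θ) ^ (q - 1))) s =
      ENNReal.ofReal (ProbabilityTheory.beta q p * (y - θ) ^ (p + q - 2)) *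
        betaPDF q p ((y - θ)⁻¹ * (s - θ)) := by
    intro s
    by_cases hs : s ∈ Ioo θ y
    · have h1 : 0 < s - θ := sub_pos.2 hs.1
      have h2 : 0 < y - s := sub_pos.2 hs.2
      have e1 : (y - θ)⁻¹ * (s - θ) = (s - θ) / (y - θ) := by ring
      have e2 : 1 - (y - θ)⁻¹ * (s - θ) = (y - s) / (y - θ) := by field_simp; ring
      have e3 : (y - θ) ^ (p + q - 2) = (y - θ) ^ (p - 1) * (y - θ) ^ (q - 1) := by
        rw [← Real.rpow_add hL]; congr 1; ring
      rw [indicator_of_mem hs, betaPDF_of_pos_lt_one (by positivity)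
        (by rw [← sub_pos, e2]; positivity), ← ENNReal.ofReal_mul (by positivity), e2, e1,
        Real.div_rpow h1.le hL.le, Real.div_rpow h2.le hL.le, e3]
      congr 1
      field_simp
    · rw [indicator_of_notMem hs]
      have : betaPDF q p ((y - θ)⁻¹ * (s - θ)) = 0 := by
        rcases le_or_gt s θ with h | h
        · exact betaPDF_eq_zero_of_nonpos
            (mul_nonpos_of_nonneg_of_nonpos (inv_pos.2 hL).le (by linarith))
        · have h' : y ≤ s := by by_contra hc; exact hs ⟨h, not_le.1 hc⟩
          refine betaPDF_eq_zero_of_one_le ?_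
          rw [inv_mul_eq_div, one_le_div hL]; linarith
      rw [this, mul_zero]
  rw [← lintegral_indicator measurableSet_Ioo, lintegral_congr hpt,
    lintegral_const_mul' _ _ ENNReal.ofReal_ne_top, hscale, ← ENNReal.ofReal_mul (by positivity)]
  congr 1
  rw [ProbabilityTheory.beta, add_comm q p, mul_assoc, ← Real.rpow_add_one hL.ne',
    show p + q - 2 + 1 = p + q - 1 by ring]
  ring

lemma measurableSet_openSimplex (m : ℕ) (θ t : ℝ) : MeasurableSet (openSimplex m θ t) := by
  have : openSimplex m θ t =
      (⋂ i : Fin m, ⋂ j : Fin m, ⋂ _ : i < j, {s | s j < s i}) ∩ ⋂ j, {s | s j ∈ Ioo θ t} := by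
    ext s
    simp [openSimplex, StrictAnti]
  rw [this]
  refine MeasurableSet.inter (MeasurableSet.iInter fun i => MeasurableSet.iInter fun j =>
    MeasurableSet.iInter fun _ => measurableSet_lt (measurable_pi_apply j) (measurable_pi_apply i))
    (MeasurableSet.iInter fun j => measurable_pi_apply j measurableSet_Ioo)

lemma cons_mem_openSimplex {m : ℕ} {θ t x : ℝ} {s : Fin m → ℝ} :
    (Fin.cons x s : Fin (m + 1) → ℝ) ∈ openSimplex (m + 1) θ t ↔
      x ∈ Ioo θ t ∧ s ∈ openSimplex m θ x := by
  constructor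
  · rintro ⟨h1, h2⟩
    have h0 : x ∈ Ioo θ t := by simpa using h2 0
    refine ⟨h0, fun i j hij => ?_, fun j => ⟨?_, ?_⟩⟩
    · simpa using h1 (Fin.succ_lt_succ_iff.2 hij)
    · simpa using (h2 j.succ).1
    · simpa using h1 (Fin.succ_pos j)
  · rintro ⟨h0, h1, h2⟩
    refine ⟨fun i j hij => ?_, fun j => ?_⟩
    · revert hij
      refine Fin.cases (fun h => absurd h (by simp)) (fun j => ?_) j
      refine Fin.cases (fun _ => ?_) (fun i h => ?_) i
      · simpa using (h2 j).2
      · simpa using h1 (Fin.succ_lt_succ_iff.1 h)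
    · refine Fin.cases ?_ (fun j => ?_) j
      · simpa using h0
      · simpa using ⟨(h2 j).1, (h2 j).2.trans h0.2⟩

lemma measurable_upGap {m : ℕ} (t : ℝ) (j : Fin m) :
    Measurable fun s : Fin m → ℝ => upGap t s j := by
  unfold upGap
  refine Measurable.sub ?_ (measurable_pi_apply j)
  refine (measurable_pi_apply j.castSucc).comp (measurable_pi_iff.2 fun i => ?_)
  refine Fin.cases ?_ (fun i => ?_) i
  · simp
  · simpa using measurable_pi_apply i

/-- The Dirichlet-type integral over the simplex, integrating out the largest variable last. Since
`w + ρ ≤ 1`, the exponents `Q` that occur in the induction stay nonnegative, so the Beta factors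
are bounded uniformly in `ρ`, up to and including the critical case `w + ρ = 1`. -/
lemma lintegral_openSimplex_le {w ρ θ : ℝ} (hw : w < 1) (hρ : 0 ≤ ρ) (hρ1 : ρ ≤ 1 / 2)
    (hwρ : w + ρ ≤ 1) : ∀ (m : ℕ) (e : Fin m → ℕ), (∀ j, e j = 0 ∨ e j = 1) → ∀ t, θ < t →
    ∫⁻ s in openSimplex m θ t,
      ENNReal.ofReal (∏ j, (upGap t s j ^ (-w) * (s j - θ) ^ (-(ρ * e j)))) ≤
    ENNReal.ofReal ((2 * Real.Gamma (1 - w)) ^ m * ((t - θ) ^ (m * (1 - w) - ρ * ∑ j, (e j : ℝ)) /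
      Real.Gamma (m * (1 - w) - ρ * ∑ j, (e j : ℝ) + 1))) := by
  intro m
  induction m with
  | zero =>
    intro e _ t _
    refine (setLIntegral_le_lintegral _ _).trans ?_
    simp [lintegral_unique, volume_pi]
  | succ m ih =>
    intro e he t ht
    set e' : Fin m → ℕ := fun j => e j.succ with he'
    set Q : ℝ := m * (1 - w) - ρ * ∑ j, (e' j : ℝ) with hQ
    have hQ0 : 0 ≤ Q := by
      have h1 : ∑ j, (e' j : ℝ) ≤ m := by
        calc ∑ j, (e' j : ℝ) ≤ ∑ _j : Fin m, (1 : ℝ) := Finset.sum_le_sum fun j _ => by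
              rcases he j.succ with h | h <;> simp [he', h]
          _ = m := by simp
      have h2 : ρ * ∑ j, (e' j : ℝ) ≤ ρ * m := mul_le_mul_of_nonneg_left h1 hρ
      have h3 : (0 : ℝ) ≤ m * (1 - w - ρ) := mul_nonneg (Nat.cast_nonneg m) (by linarith)
      linarith
    have he0 : 0 ≤ ρ * e 0 ∧ ρ * e 0 ≤ 1 / 2 := by
      rcases he 0 with h | h <;> simp only [h] <;> constructor <;> push_cast <;> linarith
    -- The integral over the first coordinate is a Beta integral with parameters `p` and `q`.
    set p : ℝ := 1 - w with hp
    set q : ℝ := Q + 1 - ρ * e 0 with hq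
    have hp0 : 0 < p := by linarith
    have hq0 : 1 / 2 ≤ q := by linarith
    have hQ' : ((m + 1 : ℕ) : ℝ) * p - ρ * ∑ j, (e j : ℝ) = p + q - 1 := by
      rw [Fin.sum_univ_succ, hq, hQ]; push_cast; ring
    rw [hQ']
    set F : (Fin (m + 1) → ℝ) → ℝ≥0∞ := (openSimplex (m + 1) θ t).indicator fun s =>
      ENNReal.ofReal (∏ j, (upGap t s j ^ (-w) * (s j - θ) ^ (-(ρ * e j)))) with hF
    have hFm : Measurable F := by
      refine Measurable.indicator ?_ (measurableSet_openSimplex _ _ _)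
      refine (Finset.measurable_fun_prod _ fun j _ => ?_).ennreal_ofReal
      have := measurable_upGap t j
      fun_prop
    have hG0 : 0 < Real.Gamma (Q + 1) := Real.Gamma_pos_of_pos (by linarith)
    have hGp : 0 < Real.Gamma p := Real.Gamma_pos_of_pos hp0
    have hGq : 0 < Real.Gamma q := Real.Gamma_pos_of_pos (by linarith)
    have hGpq : 0 < Real.Gamma (p + q) := Real.Gamma_pos_of_pos (by linarith)
    set D : ℝ := (2 * Real.Gamma p) ^ m / Real.Gamma (Q + 1) with hD
    have hD0 : 0 ≤ D := by positivity
    have hcons : ∀ x, (∫⁻ s : Fin m → ℝ, F (Fin.cons x s)) ≤ (Ioo θ t).indicator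
        (fun x => ENNReal.ofReal D *
          ENNReal.ofReal ((t - x) ^ (p - 1) * (x - θ) ^ (q - 1))) x := by
      intro x
      by_cases hx : x ∈ Ioo θ t
      · have h1 : ∀ s : Fin m → ℝ, F (Fin.cons x s) =
            ENNReal.ofReal ((t - x) ^ (-w) * (x - θ) ^ (-(ρ * e 0))) *
            (openSimplex m θ x).indicator (fun s => ENNReal.ofReal
              (∏ j, (upGap x s j ^ (-w) * (s j - θ) ^ (-(ρ * e' j))))) s := by
          intro s
          by_cases hs : s ∈ openSimplex m θ x
          · rw [hF, indicator_of_mem (cons_mem_openSimplex.2 ⟨hx, hs⟩), indicator_of_mem hs,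
              ← ENNReal.ofReal_mul (mul_nonneg (Real.rpow_nonneg (by linarith [hx.2]) _)
                (Real.rpow_nonneg (by linarith [hx.1]) _)), Fin.prod_univ_succ]
            simp only [upGap_zero, upGap_cons_succ, Fin.cons_zero, Fin.cons_succ, he']
          · rw [hF, indicator_of_notMem (fun h => hs (cons_mem_openSimplex.1 h).2),
              indicator_of_notMem hs, mul_zero]
        simp_rw [h1]
        rw [lintegral_const_mul' _ _ ENNReal.ofReal_ne_top,
          lintegral_indicator (measurableSet_openSimplex _ _ _), indicator_of_mem hx]
        refine (mul_le_mul_right (ih e' (fun j => he _) x hx.1) _).trans (le_of_eq ?_)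
        have hx1 : 0 < x - θ := sub_pos.2 hx.1
        have hx2 : 0 < t - x := sub_pos.2 hx.2
        rw [← ENNReal.ofReal_mul (by positivity), ← ENNReal.ofReal_mul hD0]
        congr 1
        rw [show p - 1 = -w by rw [hp]; ring, show q - 1 = Q + -(ρ * e 0) by rw [hq]; ring,
          Real.rpow_add hx1, hD]
        ring
      · rw [indicator_of_notMem hx]
        refine le_of_eq (lintegral_eq_zero_of_ae_eq_zero (Filter.Eventually.of_forall fun s => ?_))
        rw [hF]
        exact indicator_of_notMem (fun h => hx (cons_mem_openSimplex.1 h).1) _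
    rw [← lintegral_indicator (measurableSet_openSimplex _ _ _), ← hF,
      ← ((volume_preserving_piFinSuccAbove (fun _ => ℝ) 0).symm
      _).lintegral_comp_emb (MeasurableEquiv.measurableEmbedding _), Measure.volume_eq_prod,
      lintegral_prod (fun z => F ((MeasurableEquiv.piFinSuccAbove (fun _ => ℝ) 0).symm z))
        (Measurable.aemeasurable
        (hFm.comp (MeasurableEquiv.piFinSuccAbove (fun _ => ℝ) 0).symm.measurable))]
    simp only [MeasurableEquiv.piFinSuccAbove_symm_apply, Fin.insertNthEquiv_zero]
    refine (lintegral_mono hcons).trans ?_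
    rw [lintegral_indicator measurableSet_Ioo, lintegral_const_mul' _ _ ENNReal.ofReal_ne_top,
      lintegral_beta hp0 (by linarith) ht, ← ENNReal.ofReal_mul hD0]
    refine ENNReal.ofReal_le_ofReal ?_
    have hpow : 0 < (t - θ) ^ (p + q - 1) := Real.rpow_pos_of_pos (by linarith) _
    have hG := Gamma_le_two_mul_Gamma_add hq0 he0.1 he0.2
    rw [show q + ρ * e 0 = Q + 1 by rw [hq]; ring] at hG
    rw [show p + q - 1 + 1 = p + q by ring, hD, pow_succ]
    calc (2 * Real.Gamma p) ^ m / Real.Gamma (Q + 1) *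
          ((t - θ) ^ (p + q - 1) * (Real.Gamma p * Real.Gamma q / Real.Gamma (p + q)))
        ≤ (2 * Real.Gamma p) ^ m / Real.Gamma (Q + 1) * ((t - θ) ^ (p + q - 1) *
          (Real.Gamma p * (2 * Real.Gamma (Q + 1)) / Real.Gamma (p + q))) := by gcongr
      _ = _ := by field_simp

/-! ### Test functions and joint measurability -/

section testFunctions

variable {T : ℝ} {d : ℕ} {f : ℝ → EuclideanSpace ℝ (Fin d) → ℝ}

lemma IsTestFunction.contDiff_slice (hf : IsTestFunction T f) {s : ℝ} (hs : s ∈ Icc 0 T) :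
    ContDiff ℝ ∞ (f s) := by
  rw [← contDiffOn_univ]
  exact hf.smooth.comp (f := fun x : EuclideanSpace ℝ (Fin d) => (s, x))
    (contDiff_const.prodMk contDiff_id).contDiffOn fun x _ => ⟨hs, mem_univ _⟩

lemma IsTestFunction.hasCompactSupport_slice (hf : IsTestFunction T f) {s : ℝ}
    (hs : s ∈ Icc 0 T) : HasCompactSupport (f s) := by
  obtain ⟨K, hK, h⟩ := hf.compact_support
  exact HasCompactSupport.intro hK (h s hs)

/-- The space derivative is the joint derivative within `[0, T] × ℝ^d`, applied to a vector in the
space direction. -/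
lemma IsTestFunction.partialDeriv (hT : 0 < T) (hf : IsTestFunction T f) (l : Fin d) :
    IsTestFunction T (fun s => partialDeriv l (f s)) where
  smooth := by
    have hS : UniqueDiffOn ℝ (Icc (0 : ℝ) T ×ˢ (univ : Set (EuclideanSpace ℝ (Fin d)))) :=
      (uniqueDiffOn_Icc hT).prod uniqueDiffOn_univ
    have h := hf.smooth.fderivWithin hS (m := ∞) (by simp)
    refine (h.clm_apply (contDiffOn_const
      (c := ((0 : ℝ), (EuclideanSpace.single l (1 : ℝ)))))).congr ?_
    intro p hp
    have h1 : HasFDerivWithinAt (fun p : ℝ × EuclideanSpace ℝ (Fin d) => f p.1 p.2) _ _ p :=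
      ((hf.smooth p hp).differentiableWithinAt (by simp)).hasFDerivWithinAt
    have h2 : HasFDerivWithinAt (fun x : EuclideanSpace ℝ (Fin d) => (p.1, x))
        (ContinuousLinearMap.inr ℝ ℝ (EuclideanSpace ℝ (Fin d))) univ p.2 :=
      (hasFDerivAt_prodMk_right p.1 p.2).hasFDerivWithinAt
    have h3 := (h1.comp (f := fun x : EuclideanSpace ℝ (Fin d) => (p.1, x)) p.2 h2
      fun x _ => ⟨hp.1, mem_univ _⟩)
    rw [hasFDerivWithinAt_univ] at h3
    have h4 : fderiv ℝ (f p.1) p.2 = _ := h3.fderiv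
    simp only [_root_.partialDeriv, h4]
    simp
  compact_support := by
    obtain ⟨K, hK, h⟩ := hf.compact_support
    refine ⟨K, hK, fun s hs x hx => ?_⟩
    have h1 : f s =ᶠ[nhds x] fun _ => 0 :=
      Filter.eventually_of_mem (hK.isClosed.isOpen_compl.mem_nhds hx) fun y hy => h s hs y hy
    simp [_root_.partialDeriv, h1.fderiv_eq]

lemma IsTestFunction.multiDeriv (hT : 0 < T) (hf : IsTestFunction T f) (a : Fin d → ℕ) :
    IsTestFunction T (fun s => multiDeriv a (f s)) := by
  have h1 : ∀ (l : Fin d) (n : ℕ) (g : ℝ → EuclideanSpace ℝ (Fin d) → ℝ), IsTestFunction T g →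
      IsTestFunction T (fun s => (_root_.partialDeriv l)^[n] (g s)) := by
    intro l n
    induction n with
    | zero => intro g hg; simpa using hg
    | succ n ih => intro g hg; simpa using ih _ (hg.partialDeriv hT l)
  have h2 : ∀ L : List (Fin d), IsTestFunction T
      (fun s => L.foldr (fun l h => (_root_.partialDeriv l)^[a l] h) (f s)) := by
    intro L
    induction L with
    | nil => simpa using hf
    | cons l L ih => simpa using h1 l (a l) _ ih
  exact h2 _

lemma IsTestFunction.exists_abs_le (hf : IsTestFunction T f) :
    ∃ M, 0 ≤ M ∧ ∀ s ∈ Icc 0 T, ∀ x, |f s x| ≤ M := by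
  obtain ⟨K, hK, h⟩ := hf.compact_support
  obtain ⟨M, hM⟩ := (isCompact_Icc.prod hK).exists_bound_of_continuousOn
    (hf.smooth.continuousOn.mono (prod_mono_right (subset_univ K)))
  refine ⟨max M 0, le_max_right _ _, fun s hs x => ?_⟩
  by_cases hx : x ∈ K
  · exact (hM (s, x) ⟨hs, hx⟩).trans (le_max_left _ _)
  · simp [h s hs x hx]

/-- A test function carries no measurability in time outside `[0, T]`, hence the cut-off. -/
lemma IsTestFunction.measurable_indicator (hf : IsTestFunction T f) :
    Measurable ((Icc (0 : ℝ) T ×ˢ (univ : Set (EuclideanSpace ℝ (Fin d)))).indicator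
      fun p => f p.1 p.2) := by
  classical
  rw [← piecewise_eq_indicator]
  exact hf.smooth.continuousOn.measurable_piecewise continuousOn_const
    (measurableSet_Icc.prod MeasurableSet.univ)

/-- The essential supremum in the norm is finite, so its real value is not a junk value. -/
lemma IsTestFunction.eLpNorm_le_normLinftyL1 (hf : IsTestFunction T f) :
    ∀ᵐ s ∂(volume.restrict (Icc (0 : ℝ) T)),
      eLpNorm (f s) 1 volume ≤ ENNReal.ofReal (normLinftyL1 T f) := by
  obtain ⟨M, hM0, hM⟩ := hf.exists_abs_le
  obtain ⟨K, hK, h⟩ := hf.compact_support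
  have hb : ∀ s ∈ Icc (0 : ℝ) T, eLpNorm (f s) 1 volume ≤ ENNReal.ofReal M * volume K := by
    intro s hs
    rw [eLpNorm_one_eq_lintegral_enorm]
    calc ∫⁻ x, ‖f s x‖ₑ ≤ ∫⁻ x, K.indicator (fun _ => ENNReal.ofReal M) x := by
          refine lintegral_mono fun x => ?_
          by_cases hx : x ∈ K
          · simp only [hx, indicator_of_mem, Real.enorm_eq_ofReal_abs]
            exact ENNReal.ofReal_le_ofReal (hM s hs x)
          · simp [hx, h s hs x hx]
      _ = _ := by rw [lintegral_indicator hK.measurableSet]; simp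
  have hfin : essSup (fun s => eLpNorm (f s) 1 volume) (volume.restrict (Icc (0 : ℝ) T)) ≠ ⊤ := by
    refine ne_top_of_le_ne_top (ENNReal.mul_ne_top (ENNReal.ofReal_ne_top (r := M))
      (hK.measure_lt_top (μ := volume)).ne) ?_
    exact essSup_le_of_ae_le _ ((ae_restrict_iff' measurableSet_Icc).2 (ae_of_all _ hb))
  rw [normLinftyL1, ENNReal.ofReal_toReal hfin]
  exact ENNReal.ae_le_essSup _

end testFunctions

section joint

variable {Ω : Type*} [MeasurableSpace Ω] {P : Measure Ω} {T H : ℝ} {d : ℕ}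
  {B : ℝ → Ω → EuclideanSpace ℝ (Fin d)}

/-- Jointly measurable approximations of the process. Each `B t` is only almost everywhere
measurable, so the paths are sampled at the times `⌊s n⌋ / n` and the countably many random
variables that occur are replaced by measurable versions. -/
lemma IsFractionalBrownianMotion.exists_measurable_approx (hT : 0 < T)
    (hB : IsFractionalBrownianMotion P T H B) :
    ∃ G : ℕ → Ω × ℝ → EuclideanSpace ℝ (Fin d), (∀ n, Measurable (G n)) ∧
      ∀ᵐ w ∂P, ∀ s ∈ Icc 0 T, Filter.Tendsto (fun n => G n (w, s)) Filter.atTop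
        (nhds (B s w)) := by
  have hp : ∀ x : ℝ, (projIcc 0 T hT.le x : ℝ) ∈ Icc 0 T := fun x => (projIcc 0 T hT.le x).2
  have h0 : ∀ k n : ℕ, ∃ g : Ω → EuclideanSpace ℝ (Fin d), Measurable g ∧
      B (projIcc 0 T hT.le (k / n)) =ᵐ[P] g := fun k n => hB.aemeasurable (hp _)
  choose A hA hAB using h0
  refine ⟨fun n z => A ⌊z.2 * n⌋₊ n z.1, fun n => ?_, ?_⟩
  · have h1 : Measurable (fun y : Ω × ℕ => A y.2 n y.1) :=
      measurable_from_prod_countable_left fun k => hA k n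
    exact h1.comp (measurable_fst.prodMk (Nat.measurable_floor.comp
      (measurable_snd.mul_const _)))
  · have h2 : ∀ᵐ w ∂P, ∀ k n : ℕ, B (projIcc 0 T hT.le (k / n)) w = A k n w :=
      ae_all_iff.2 fun k => ae_all_iff.2 fun n => hAB k n
    filter_upwards [h2, hB.continuous_paths] with w hw hc s hs
    simp only [← hw]
    have h3 : Filter.Tendsto (fun n : ℕ => (⌊s * n⌋₊ : ℝ) / n) Filter.atTop (nhds s) :=
      (tendsto_nat_floor_mul_div_atTop hs.1).comp tendsto_natCast_atTop_atTop
    have h4 : Filter.Tendsto (fun n : ℕ => (projIcc 0 T hT.le ((⌊s * n⌋₊ : ℝ) / n) : ℝ))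
        Filter.atTop (nhds s) := by
      have := ((continuous_subtype_val.comp continuous_projIcc).tendsto s
        (f := fun x => (projIcc 0 T hT.le x : ℝ))).comp h3
      rwa [projIcc_of_mem hT.le hs] at this
    exact (hc s hs).tendsto.comp (tendsto_nhdsWithin_iff.2 ⟨h4, Filter.Eventually.of_forall
      fun n => hp _⟩)

lemma openSimplex_subset {m : ℕ} {θ t : ℝ} (hθ : 0 ≤ θ) (ht : t ≤ T) {s : Fin m → ℝ}
    (hs : s ∈ openSimplex m θ t) (j : Fin m) : s j ∈ Icc 0 T :=
  ⟨hθ.trans (hs.2 j).1.le, (hs.2 j).2.le.trans ht⟩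

lemma ae_prod_openSimplex [IsProbabilityMeasure P] {m : ℕ} {θ t : ℝ} :
    ∀ᵐ z ∂(P.prod (volume.restrict (openSimplex m θ t))), z.2 ∈ openSimplex m θ t :=
  Measure.quasiMeasurePreserving_snd.ae (ae_restrict_mem (measurableSet_openSimplex m θ t))

lemma IsFractionalBrownianMotion.aemeasurable_joint [IsProbabilityMeasure P] (hT : 0 < T)
    (hB : IsFractionalBrownianMotion P T H B) {m : ℕ} {θ t : ℝ} (hθ : 0 ≤ θ) (ht : t ≤ T)
    (j : Fin m) :
    AEMeasurable (fun z : Ω × (Fin m → ℝ) => B (z.2 j) z.1)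
      (P.prod (volume.restrict (openSimplex m θ t))) := by
  obtain ⟨G, hG, hlim⟩ := hB.exists_measurable_approx hT
  refine aemeasurable_of_tendsto_metrizable_ae Filter.atTop
    (f := fun n (z : Ω × (Fin m → ℝ)) => G n (z.1, z.2 j)) (fun n => ?_) ?_
  · exact ((hG n).comp (measurable_fst.prodMk
      ((measurable_pi_apply j).comp measurable_snd))).aemeasurable
  · filter_upwards [Measure.quasiMeasurePreserving_fst.ae hlim, ae_prod_openSimplex] with z h1 h2
    exact h1 _ (openSimplex_subset hθ ht h2 j)

lemma aemeasurable_weightedIntegrand [IsProbabilityMeasure P] (hH0 : 0 < H) (hT : 0 < T)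
    (hB : IsFractionalBrownianMotion P T H B) {m : ℕ} (e : Fin m → ℕ) (a : Fin m → Fin d → ℕ)
    {f : Fin m → ℝ → EuclideanSpace ℝ (Fin d) → ℝ} (hf : ∀ j, IsTestFunction T (f j))
    {θ' θ t : ℝ} (hθ' : 0 < θ') (hθθ : θ' ≤ θ) (hθt : θ ≤ t) (ht : t ≤ T) :
    AEMeasurable (fun z : Ω × (Fin m → ℝ) =>
      weightedIntegrand H θ' θ e a f (fun r => B r z.1) z.2)
      (P.prod (volume.restrict (openSimplex m θ t))) := by
  classical
  have hθ : 0 < θ := hθ'.trans_le hθθ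
  refine Finset.aemeasurable_fun_prod _ fun j _ => AEMeasurable.mul ?_ (AEMeasurable.pow_const ?_ _)
  · have h1 := ((hf j).multiDeriv hT (a j)).measurable_indicator
    have h2 : AEMeasurable (fun z : Ω × (Fin m → ℝ) => (z.2 j, B (z.2 j) z.1))
        (P.prod (volume.restrict (openSimplex m θ t))) :=
      ((measurable_pi_apply j).comp measurable_snd).aemeasurable.prodMk
        (hB.aemeasurable_joint hT hθ.le ht j)
    refine (h1.comp_aemeasurable h2).congr ?_
    filter_upwards [ae_prod_openSimplex] with z hz
    simp only [Function.comp]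
    rw [indicator_of_mem]
    exact ⟨openSimplex_subset hθ.le ht hz j, mem_univ _⟩
  · have hc : ContinuousOn (fun s => volterraKernel H s θ - volterraKernel H s θ') (Ioc θ t) :=
      (continuousOn_volterraKernel hH0 hθ hθt).sub
        ((continuousOn_volterraKernel hH0 hθ' (hθθ.trans hθt)).mono (Ioc_subset_Ioc_left hθθ))
    have h1 : Measurable ((Ioc θ t).indicator
        fun s => volterraKernel H s θ - volterraKernel H s θ') := by
      rw [← piecewise_eq_indicator]
      exact hc.measurable_piecewise continuousOn_const measurableSet_Ioc
    refine (h1.comp ((measurable_pi_apply j).comp measurable_snd)).aemeasurable.congr ?_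
    filter_upwards [ae_prod_openSimplex] with z hz
    simp only [Function.comp]
    rw [indicator_of_mem]
    exact Ioo_subset_Ioc_self (hz.2 j)

end joint

/-! ### Integrability and the final estimate -/

section bounds

variable {Ω : Type*} [MeasurableSpace Ω] {P : Measure Ω} {T H : ℝ} {d m : ℕ}
  {B : ℝ → Ω → EuclideanSpace ℝ (Fin d)}

/-- The case `w = 0` of the simplex integral. -/
lemma integrableOn_prod_rpow {ρ θ t : ℝ} (hρ : 0 ≤ ρ) (hρ1 : ρ ≤ 1 / 2) (hθ : θ < t)
    {e : Fin m → ℕ} (he : ∀ j, e j = 0 ∨ e j = 1) :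
    IntegrableOn (fun s : Fin m → ℝ => ∏ j, (s j - θ) ^ (-(ρ * e j))) (openSimplex m θ t) := by
  refine ⟨Measurable.aestronglyMeasurable (by fun_prop), ?_⟩
  have h := lintegral_openSimplex_le (w := 0) (θ := θ) one_pos hρ hρ1 (by linarith) m e he t hθ
  refine lt_of_le_of_lt (le_of_eq ?_) (h.trans_lt ENNReal.ofReal_lt_top)
  refine setLIntegral_congr_fun (measurableSet_openSimplex m θ t) fun s hs => ?_
  have h0 : ∀ j, 0 ≤ (s j - θ) ^ (-(ρ * e j)) := fun j =>
    Real.rpow_nonneg (by linarith [(hs.2 j).1]) _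
  simp only [neg_zero, Real.rpow_zero, one_mul]
  rw [Real.enorm_of_nonneg (Finset.prod_nonneg fun j _ => h0 j)]

lemma abs_pow_le_of_zero_or_one {A x h y γ ρ : ℝ} (hA : 1 ≤ A) {e : ℕ} (he : e = 0 ∨ e = 1)
    (hx : |x| ≤ A * (h ^ γ * y ^ (-ρ))) :
    |x ^ e| ≤ A * (h ^ (γ * e) * y ^ (-(ρ * e))) := by
  rcases he with rfl | rfl
  · simpa using hA
  · simpa using hx

lemma abs_prod_le_mul_prod {κ : Fin m → ℝ} {s : Fin m → ℝ} {A h γ ρ θ : ℝ} (hh : 0 < h)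
    {e : Fin m → ℕ}
    (hκ : ∀ j, |κ j| ≤ A * (h ^ (γ * e j) * (s j - θ) ^ (-(ρ * e j)))) :
    |∏ j, κ j| ≤ A ^ m * h ^ (γ * ∑ j, (e j : ℝ)) * ∏ j, (s j - θ) ^ (-(ρ * e j)) := by
  rw [Finset.abs_prod]
  refine (Finset.prod_le_prod (fun j _ => abs_nonneg _) fun j _ => hκ j).trans (le_of_eq ?_)
  rw [Finset.prod_mul_distrib, Finset.prod_mul_distrib, Finset.mul_sum,
    Real.rpow_sum_of_pos hh]
  simp [mul_assoc]

/-- On the product of `Ω` and the simplex the integrand is dominated by a multiple of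
`∏ (s_j - θ) ^ (-(ρ e_j))`, since test functions are bounded. -/
lemma integrable_weightedIntegrand [IsProbabilityMeasure P] (hH0 : 0 < H) (hT : 0 < T)
    (hB : IsFractionalBrownianMotion P T H B) {e : Fin m → ℕ} (he : ∀ j, e j = 0 ∨ e j = 1)
    (a : Fin m → Fin d → ℕ)
    {f : Fin m → ℝ → EuclideanSpace ℝ (Fin d) → ℝ} (hf : ∀ j, IsTestFunction T (f j))
    {θ' θ t : ℝ} (hθ' : 0 < θ') (hθθ : θ' < θ) (hθt : θ < t) (ht : t ≤ T)
    {A γ ρ : ℝ} (hA : 1 ≤ A) (hρ : 0 ≤ ρ) (hρ1 : ρ ≤ 1 / 2)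
    (hκ : ∀ s ∈ Ioo θ t, |volterraKernel H s θ - volterraKernel H s θ'| ≤
      A * ((θ - θ') ^ γ * (s - θ) ^ (-ρ))) :
    Integrable (fun z : Ω × (Fin m → ℝ) =>
      weightedIntegrand H θ' θ e a f (fun r => B r z.1) z.2)
      (P.prod (volume.restrict (openSimplex m θ t))) := by
  have hθ : 0 < θ := hθ'.trans hθθ
  choose M hM0 hM using fun j => ((hf j).multiDeriv hT (a j)).exists_abs_le
  refine (((integrableOn_prod_rpow hρ hρ1 hθt he).comp_snd P).const_mul
    ((∏ j, M j) * (A ^ m * (θ - θ') ^ (γ * ∑ j, (e j : ℝ))))).mono'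
    (aemeasurable_weightedIntegrand hH0 hT hB e a hf hθ' hθθ.le hθt.le ht).aestronglyMeasurable ?_
  filter_upwards [ae_prod_openSimplex] with z hz
  rw [weightedIntegrand, Finset.prod_mul_distrib, Real.norm_eq_abs, abs_mul, mul_assoc]
  refine mul_le_mul ?_ ?_ (abs_nonneg _) (Finset.prod_nonneg fun j _ => hM0 j)
  · rw [Finset.abs_prod]
    exact Finset.prod_le_prod (fun j _ => abs_nonneg _) fun j _ =>
      hM j _ (openSimplex_subset hθ.le ht hz j) _
  · exact abs_prod_le_mul_prod (sub_pos.2 hθθ) fun j =>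
      abs_pow_le_of_zero_or_one hA (he j) (hκ _ (hz.2 j))

lemma ae_prod_eLpNorm_le {f : Fin m → ℝ → EuclideanSpace ℝ (Fin d) → ℝ}
    (hf : ∀ j, IsTestFunction T (f j)) {θ t : ℝ} (hθ : 0 ≤ θ) (ht : t ≤ T) :
    ∀ᵐ s ∂(volume.restrict (openSimplex m θ t)),
      ∏ j, eLpNorm (f j (s j)) 1 volume ≤ ENNReal.ofReal (∏ j, normLinftyL1 T (f j)) := by
  have h1 : ∀ j, ∀ᵐ s : Fin m → ℝ, s j ∈ Icc 0 T →
      eLpNorm (f j (s j)) 1 volume ≤ ENNReal.ofReal (normLinftyL1 T (f j)) := fun j =>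
    (Measure.quasiMeasurePreserving_eval (fun _ : Fin m => (volume : Measure ℝ)) j).ae
      ((ae_restrict_iff' measurableSet_Icc).1 (hf j).eLpNorm_le_normLinftyL1)
  filter_upwards [ae_restrict_of_ae (ae_all_iff.2 h1),
    ae_restrict_mem (measurableSet_openSimplex m θ t)] with s hs hmem
  rw [ENNReal.ofReal_prod_of_nonneg (f := fun j => normLinftyL1 T (f j))
    fun j _ => ENNReal.toReal_nonneg]
  exact Finset.prod_le_prod' fun j _ => hs j (openSimplex_subset hθ ht hmem j)

end bounds

lemma one_div_Gamma_le {Q : ℝ} {m : ℕ} (hm : 1 ≤ m) (hQ : 0 ≤ Q) (hQm : Q ≤ m) :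
    1 / Real.Gamma (Q + 1) ≤ 4 ^ m / √(Real.Gamma (2 * Q + 1)) := by
  have h1 := sqrt_Gamma_le hQ hQm
  have h2 : 0 < Real.Gamma (Q + 1) := Real.Gamma_pos_of_pos (by linarith)
  have h3 : 0 < √(Real.Gamma (2 * Q + 1)) :=
    Real.sqrt_pos.2 (Real.Gamma_pos_of_pos (by linarith))
  have h4 : (2 : ℝ) * 2 ^ m ≤ 4 ^ m := by
    have : (2 : ℝ) ^ 1 ≤ 2 ^ m := pow_le_pow_right₀ (by norm_num) hm
    have e : (4 : ℝ) ^ m = 2 ^ m * 2 ^ m := by rw [← mul_pow]; norm_num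
    rw [e]; nlinarith [pow_pos (two_pos : (0 : ℝ) < 2) m]
  rw [div_le_div_iff₀ h2 h3, one_mul]
  exact h1.trans (by gcongr)

end ofENNReal

theorem mainTheorem5 (d k : ℕ) (hd : 1 ≤ d) (H : ℝ) (hH0 : 0 < H) (hH : H < 1 / 2)
    (hHk : HurstCondition H d k) (T : ℝ) (θ₀ : ℝ) (hθ₀ : 0 < θ₀) :
    ∃ C : ℝ, 0 < C ∧
      ∀ (Ω : Type*) [MeasurableSpace Ω] (P : Measure Ω) [IsProbabilityMeasure P]
        (B : ℝ → Ω → EuclideanSpace ℝ (Fin d)), IsFractionalBrownianMotion P T H B →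
      ∀ (m : ℕ), 1 ≤ m →
      ∀ (ε : Fin m → ℕ), (∀ j, ε j = 0 ∨ ε j = 1) →
      ∀ (α : Fin m → Fin d → ℕ), (∀ j l, α j l ≤ k) →
      ∀ (f : Fin m → ℝ → EuclideanSpace ℝ (Fin d) → ℝ), (∀ j, IsTestFunction T (f j)) →
      ∀ (θ' θ t : ℝ), θ₀ ≤ θ' → θ' < θ → θ < t → t ≤ T →
      ∀ (γ : ℝ), 0 < γ → γ < H → γ ≤ 1 / 2 - ((d : ℝ) * (2 * k + 1) - 1) * H →
        (∀ᵐ w ∂P, IntegrableOn (weightedIntegrand H θ' θ ε α f (fun r => B r w))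
          (openSimplex m θ t)) ∧
        Integrable (fun w => ∫ s in openSimplex m θ t,
          weightedIntegrand H θ' θ ε α f (fun r => B r w) s) P ∧
        |∫ w, (∫ s in openSimplex m θ t,
          weightedIntegrand H θ' θ ε α f (fun r => B r w) s) ∂P| ≤
          C ^ m * (∏ j, normLinftyL1 T (f j)) *
            (|θ' - θ| ^ (γ * ∑ j, (ε j : ℝ)) *
              |t - θ| ^ ((m : ℝ) * (1 - d * (2 * k + 1) * H)
                + (H - 1 / 2 - γ) * ∑ j, (ε j : ℝ)) /
              Real.sqrt (Real.Gamma (2 * m * (1 - d * H * (2 * k + 1)) + 1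
                + 2 * (H - 1 / 2 - γ) * ∑ j, (ε j : ℝ)))) := by
  obtain ⟨C₁, hC₁, hmom⟩ := lintegral_moment_le d k hH0 hH T hθ₀
  obtain ⟨A₀, hA₀, hker⟩ := exists_abs_volterraKernel_sub_le hH0 hH hθ₀ T
  set w : ℝ := d * (2 * k + 1) * H with hw
  have hd1 : (1 : ℝ) ≤ d := by exact_mod_cast hd
  have hD : (1 : ℝ) ≤ d * (2 * k + 1) := by
    have : (0 : ℝ) ≤ k := k.cast_nonneg
    nlinarith
  -- The case `n = 1`, `e = 0` of the condition on `H`.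
  have hw1 : w < 1 := by
    have h := hHk 1 le_rfl (fun _ => 0) (fun _ => Or.inl rfl) (by simp; linarith)
    simp only [Nat.cast_one, Nat.cast_zero, Finset.sum_const_zero, mul_zero, sub_zero,
      one_mul] at h
    rw [lt_div_iff₀ (by linarith)] at h
    rw [hw]; linarith
  set A : ℝ := max A₀ 1 with hAdef
  have hA : 1 ≤ A := le_max_right _ _
  have hΓw : 0 < Real.Gamma (1 - w) := Real.Gamma_pos_of_pos (by linarith)
  -- The factor `4` comes from `one_div_Gamma_le`.
  refine ⟨C₁ * A * (2 * Real.Gamma (1 - w)) * 4, by positivity, ?_⟩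
  intro Ω _ P _ B hB m hm ε hε α hα f hf θ' θ t hθ' hθθ hθt ht γ hγ hγH hγ1
  have hθ'0 : 0 < θ' := hθ₀.trans_le hθ'
  have hθ0 : 0 < θ := hθ'0.trans hθθ
  have hT : 0 < T := by linarith
  set ρ : ℝ := 1 / 2 - H + γ with hρdef
  have hρ : 0 ≤ ρ := by linarith
  have hρ1 : ρ ≤ 1 / 2 := by linarith
  have hwρ : w + ρ ≤ 1 := by rw [hw, hρdef]; linarith
  set h : ℝ := θ - θ' with hh
  have hh0 : 0 < h := sub_pos.2 hθθ
  set E : ℝ := ∑ j, (ε j : ℝ) with hE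
  have hE0 : 0 ≤ E := Finset.sum_nonneg fun j _ => Nat.cast_nonneg _
  have hEm : E ≤ m := by
    have : E ≤ ∑ _j : Fin m, (1 : ℝ) := Finset.sum_le_sum fun j _ => by
      rcases hε j with h | h <;> simp [h]
    simpa using this
  set Q : ℝ := m * (1 - w) - ρ * E with hQ
  have hQ0 : 0 ≤ Q := by
    have : ρ * E ≤ ρ * m := by gcongr
    have h2 : (0 : ℝ) ≤ m := m.cast_nonneg
    rw [hQ]; nlinarith
  have hQm : Q ≤ m := by
    have h2 : (0 : ℝ) ≤ m := m.cast_nonneg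
    have h3 : 0 ≤ w := by rw [hw]; positivity
    have h4 : 0 ≤ ρ * E := by positivity
    rw [hQ]; nlinarith
  have hκ : ∀ s ∈ Ioo θ t, |volterraKernel H s θ - volterraKernel H s θ'| ≤
      A * (h ^ γ * (s - θ) ^ (-ρ)) := by
    intro s hs
    have h1 := hker θ' θ s γ hθ' hθθ hs.1 (hs.2.le.trans ht) hγ hγH
    rw [show H - 1 / 2 - γ = -ρ by rw [hρdef]; ring] at h1
    refine h1.trans ?_
    have : 0 < s - θ := sub_pos.2 hs.1
    gcongr
    exact le_max_left _ _
  have hint := integrable_weightedIntegrand hH0 hT hB hε α hf hθ'0 hθθ hθt ht hA hρ hρ1 hκ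
  refine ⟨hint.prod_right_ae, hint.integral_prod_left, ?_⟩
  set N : ℝ := ∏ j, normLinftyL1 T (f j) with hN
  have hN0 : 0 ≤ N := Finset.prod_nonneg fun j _ => ENNReal.toReal_nonneg
  have hΓ : 0 < Real.Gamma (Q + 1) := Real.Gamma_pos_of_pos (by linarith)
  set c : ℝ := N * C₁ ^ m * (A ^ m * h ^ (γ * E)) with hc
  have hc0 : 0 ≤ c := by positivity
  -- Pointwise bound of the expectation of the integrand at a fixed point of the simplex.
  have hpt : ∀ᵐ s ∂(volume.restrict (openSimplex m θ t)),
      ‖∫ w, weightedIntegrand H θ' θ ε α f (fun r => B r w) s ∂P‖ₑ ≤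
        ENNReal.ofReal c *
          ENNReal.ofReal (∏ j, (upGap t s j ^ (-w) * (s j - θ) ^ (-(ρ * ε j)))) := by
    filter_upwards [ae_prod_eLpNorm_le hf hθ0.le ht,
      ae_restrict_mem (measurableSet_openSimplex m θ t)] with s hs hmem
    have hsT := openSimplex_subset hθ0.le ht hmem
    have hup : ∀ j, 0 < upGap t s j := by
      obtain ⟨n, rfl⟩ : ∃ n, m = n + 1 := ⟨m - 1, by omega⟩
      exact upGap_pos hmem
    have h1 := enorm_integral_prod_multiDeriv_le hB hH0 hH hsT α
      (fun j => (hf j).contDiff_slice (hsT j)) (fun j => (hf j).hasCompactSupport_slice (hsT j))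
    have h2 : ∫⁻ ξ : Fin m → EuclideanSpace ℝ (Fin d),
        ENNReal.ofReal ((∏ j, ∏ l, (2 * Real.pi * |ξ j l|) ^ α j l) *
          Real.exp (-(2 * Real.pi ^ 2) * ∑ l, ‖∑ j, ξ j l • fbmVec hH0 hH (s j)‖ ^ 2)) ≤
        ENNReal.ofReal (C₁ ^ m * ∏ j, upGap t s j ^ (-w)) := by
      obtain ⟨n, rfl⟩ : ∃ n, m = n + 1 := ⟨m - 1, by omega⟩
      exact hmom n θ t (hθ'.trans hθθ.le) ht s hmem α hα
    have h3 : |∏ j, (volterraKernel H (s j) θ - volterraKernel H (s j) θ') ^ ε j| ≤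
        A ^ m * h ^ (γ * E) * ∏ j, (s j - θ) ^ (-(ρ * ε j)) :=
      abs_prod_le_mul_prod hh0 fun j => abs_pow_le_of_zero_or_one hA (hε j) (hκ _ (hmem.2 j))
    have hp1 : 0 ≤ ∏ j, upGap t s j ^ (-w) :=
      Finset.prod_nonneg fun j _ => Real.rpow_nonneg (hup j).le _
    simp only [weightedIntegrand, Finset.prod_mul_distrib]
    rw [integral_mul_const, enorm_mul, Real.enorm_eq_ofReal_abs (∏ j, (_ - _) ^ ε j)]
    refine (mul_le_mul' (h1.trans (mul_le_mul' hs h2)) (ENNReal.ofReal_le_ofReal h3)).trans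
      (le_of_eq ?_)
    rw [← ENNReal.ofReal_mul hN0, ← ENNReal.ofReal_mul (by positivity),
      ← ENNReal.ofReal_mul hc0]
    congr 1
    rw [hc]; ring
  have hmain : ‖∫ w, (∫ s in openSimplex m θ t,
      weightedIntegrand H θ' θ ε α f (fun r => B r w) s) ∂P‖ₑ ≤
      ENNReal.ofReal (c * ((2 * Real.Gamma (1 - w)) ^ m *
        ((t - θ) ^ Q / Real.Gamma (Q + 1)))) := by
    rw [integral_integral_swap hint]
    refine (enorm_integral_le_lintegral_enorm _).trans ((lintegral_mono_ae hpt).trans ?_)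
    rw [lintegral_const_mul' _ _ ENNReal.ofReal_ne_top, ENNReal.ofReal_mul hc0]
    gcongr
    exact lintegral_openSimplex_le hw1 hρ hρ1 hwρ m ε hε t hθt
  have htθ : 0 < t - θ := sub_pos.2 hθt
  rw [Real.enorm_eq_ofReal_abs, ENNReal.ofReal_le_ofReal_iff (by positivity)] at hmain
  refine hmain.trans ?_
  have e1 : |θ' - θ| = h := by rw [abs_sub_comm, abs_of_pos hh0]
  have e2 : (m : ℝ) * (1 - w) + (H - 1 / 2 - γ) * E = Q := by rw [hQ, hρdef]; ring
  have e3 : 2 * m * (1 - d * H * (2 * k + 1)) + 1 + 2 * (H - 1 / 2 - γ) * E = 2 * Q + 1 := by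
    rw [hQ, hρdef, hw]; ring
  rw [e1, abs_of_pos htθ, e2, e3]
  calc c * ((2 * Real.Gamma (1 - w)) ^ m * ((t - θ) ^ Q / Real.Gamma (Q + 1)))
      = c * ((2 * Real.Gamma (1 - w)) ^ m * ((t - θ) ^ Q * (1 / Real.Gamma (Q + 1)))) := by ring
    _ ≤ c * ((2 * Real.Gamma (1 - w)) ^ m *
        ((t - θ) ^ Q * (4 ^ m / √(Real.Gamma (2 * Q + 1))))) := by
      refine mul_le_mul_of_nonneg_left (mul_le_mul_of_nonneg_left (mul_le_mul_of_nonneg_left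
        (one_div_Gamma_le hm hQ0 hQm) ?_) ?_) hc0 <;> positivity
    _ = _ := by rw [hc, mul_pow, mul_pow, mul_pow]; ring
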